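/- Let $k$ be a field. All algebras are associative $k$-algebras, not necessarily unital. For an algebra $A$, $M(A)$ is its multiplier algebra. Let $Q$ be a regular multiplier Hopf algebra: an algebra with nondegenerate product and a homomorphism $\Delta:Q\to M(Q\otimes Q)$ such that $T_1(x\otimes y)=\Delta(x)(1\otimes y)$ and $T_2(x\otimes y)=(x\otimes 1)\Delta(y)$ lie in $Q\otimes Q$, $(T_2\otimes\mathrm{id})(\mathrm{id}\otimes T_1)=(\mathrm{id}\otimes T_1)(T_2\otimes\mathrm{id})$, and $T_1,T_2$ are bijective on $Q\otimes Q$, and such that the same holds for $\tau\Delta$, where $\tau$ is the flip. It has a unique counit $\varepsilon$ and a unique antipode $S$, and $S:Q\to Q$ is bijective. Let $A$ be a $Q$-bimodule algebra: $A$ has commuting left and right $Q$-module structures $\rhd,\lhd$ that are unital ($Q\rhd A=A=A\lhd Q$) and satisfy $x\rhd(ab)=\sum(x_1\rhd a)(x_2\rhd b)$ and $(ab)\lhd x=\sum(a\lhd x_1)(b\lhd x_2)$. Let $B$ be a $Q$-bicomodule algebra: an algebra with nondegenerate product and injective homomorphisms $\Gamma:B\to M(Q\otimes B)$, $\Upsilon:B\to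 M(B\otimes Q)$ such that $\Gamma(b)(x\otimes1),\ (x\otimes1)\Gamma(b)\in Q\otimes B$ and $\Upsilon(b)(1\otimes x),\ (1\otimes x)\Upsilon(b)\in B\otimes Q$, $(\mathrm{id}\otimes\Gamma)\Gamma=(\Delta\otimes\mathrm{id})\Gamma$, $(\Upsilon\otimes\mathrm{id})\Upsilon=(\mathrm{id}\otimes\Delta)\Upsilon$, and $(1\otimes1\otimes x)\big((\mathrm{id}\otimes\Upsilon)(\Gamma(b)(y\otimes1))\big)=\big((\Gamma\otimes\mathrm{id})((1\otimes x)\Upsilon(b))\big)(y\otimes1\otimes1)$. Write $\Gamma(b)=\sum b_{(-1)}\otimes b_0$, $\Upsilon(b)=\sum b_0\otimes b_{(1)}$, and $\sum b_{(-1)}\otimes b_0\otimes b_{(1)}$ for $(\Gamma\otimes\mathrm{id})\Upsilon(b)=(\mathrm{id}\otimes\Upsilon)\Gamma(b)$. Then the maps $b\otimes a\mapsto\sum b_0\otimes(b_{(-1)}\rhd a)$, $b\otimes a\mapsto\sum b_0\otimes(S^{-1}(b_{(-1)})\rhd a)$, $a\otimes b\mapsto\sum b_0\otimes(a\lhd b_{(1)})$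 and $a\otimes b\mapsto\sum b_0\otimes(a\lhd S^{-1}(b_{(1)}))$ are well defined (the coactions being covered through the unital actions), and with the multiplications on $B\otimes A$ and on $A\otimes B$ built from them, $$B\diamond^Q_rA:\quad (b'\diamond a')(b\diamond a)=\sum b'_0b_0\diamond(a'\lhd b_{(1)})(b'_{(-1)}\rhd a),$$ $$B\star^Q_rA:\quad (b'\star a')(b\star a)=\sum b'b_0\star(S^{-1}(b_{(-1)})\rhd a'\lhd b_{(1)})\,a,$$ $$A\diamond^Q_lB:\quad (a\diamond b)(a'\diamond b')=\sum(a\lhd b'_{(1)})(b_{(-1)}\rhd a')\diamond b_0b'_0,$$ $$A\star^Q_lB:\quad (a\star b)(a'\star b')=\sum a\,(b_{(-1)}\rhd a'\lhd S^{-1}(b_{(1)}))\star b_0b',$$ the map $b\star a\mapsto\sum b_0\diamond(b_{(-1)}\rhd a)$ is an isomorphism of algebras $B\star^Q_rA\to B\diamond^Q_rA$, and the map $a\star b\mapsto\sum(a\lhd b_{(1)})\diamond b_0$ is an isomorphism of algebras $A\star^Q_lB\to A\diamond^Q_lB$. -/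

import Mathlib

open scoped TensorProduct

namespace MultHopf

section Multipliers

/-- The multiplier algebra `M(A)` of an algebra `A` over `k`: all pairs `(m₁, m₂)` of linear
endomorphisms of `A` with `m₂(a) b = a m₁(b)`; the product is
`(m₁, m₂) (n₁, n₂) = (m₁ ∘ n₁, n₂ ∘ m₂)`. -/
def multiplierSubalgebra (k A : Type*) [Field k] [NonUnitalRing A] [Module k A]
    [IsScalarTower k A A] [SMulCommClass k A A] :
    Subalgebra k (Module.End k A × (Module.End k A)ᵐᵒᵖ) where
  carrier := {m | ∀ a b : A, m.2.unop a * b = a * m.1 b}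
  mul_mem' := by
    intro m n hm hn a b
    change n.2.unop (m.2.unop a) * b = a * m.1 (n.1 b)
    rw [hn, hm]
  add_mem' := by
    intro m n hm hn a b
    change (m.2.unop a + n.2.unop a) * b = a * (m.1 b + n.1 b)
    rw [add_mul, mul_add, hm, hn]
  algebraMap_mem' := by
    intro c a b
    change (c • a) * b = a * (c • b)
    rw [smul_mul_assoc, mul_smul_comm]

/-- The multiplier algebra `M(A)`, as a type. -/
abbrev Multiplier (k A : Type*) [Field k] [NonUnitalRing A] [Module k A]
    [IsScalarTower k A A] [SMulCommClass k A A] : Type _ :=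
  multiplierSubalgebra k A

namespace Multiplier

variable {k A X Y : Type*} [Field k]
  [NonUnitalRing A] [Module k A] [IsScalarTower k A A] [SMulCommClass k A A]
  [NonUnitalRing X] [Module k X] [IsScalarTower k X X] [SMulCommClass k X X]
  [NonUnitalRing Y] [Module k Y] [IsScalarTower k Y Y] [SMulCommClass k Y Y]

/-- `a ↦ m a`. -/
def left (m : Multiplier k A) : A →ₗ[k] A := m.1.1

/-- `a ↦ a m`. -/
def right (m : Multiplier k A) : A →ₗ[k] A := m.1.2.unop

theorem right_mul_eq (m : Multiplier k A) (a b : A) : m.right a * b = a * m.left b :=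
  m.2 a b

/-- The multiplier with given components. -/
def mk (l r : A →ₗ[k] A) (h : ∀ a b : A, r a * b = a * l b) : Multiplier k A :=
  ⟨(l, MulOpposite.op r), h⟩

/-- The canonical map `A → M(A)`, `a ↦ (a ·, · a)`. -/
def ofAlg (a : A) : Multiplier k A :=
  mk (LinearMap.mulLeft k a) (LinearMap.mulRight k a) (fun b c => mul_assoc b a c)

/-- The canonical map `M(X) ⊗ M(Y) → M(X ⊗ Y)` on pure tensors. -/
noncomputable def tmul (m : Multiplier k X) (n : Multiplier k Y) : Multiplier k (X ⊗[k] Y) :=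
  mk (TensorProduct.map m.left n.left) (TensorProduct.map m.right n.right) (by
    intro u v
    induction u using TensorProduct.induction_on with
    | zero => simp
    | add u u' hu hu' => rw [map_add, add_mul, add_mul, hu, hu']
    | tmul x y =>
      induction v using TensorProduct.induction_on with
      | zero => simp
      | add v v' hv hv' => rw [map_add, mul_add, mul_add, hv, hv']
      | tmul x' y' => simp [right_mul_eq])

theorem comm_mul (u v : X ⊗[k] Y) :
    TensorProduct.comm k X Y (u * v)
      = TensorProduct.comm k X Y u * TensorProduct.comm k X Y v := by
  induction u using TensorProduct.induction_on with
  | zero => simp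
  | add u u' hu hu' => rw [add_mul, map_add, map_add, add_mul, hu, hu']
  | tmul x y =>
    induction v using TensorProduct.induction_on with
    | zero => simp
    | add v v' hv hv' => rw [mul_add, map_add, map_add, mul_add, hv, hv']
    | tmul x' y' => simp

/-- The flip `M(X ⊗ Y) → M(Y ⊗ X)`, the extension of `x ⊗ y ↦ y ⊗ x` to multipliers. -/
noncomputable def flip (m : Multiplier k (X ⊗[k] Y)) : Multiplier k (Y ⊗[k] X) :=
  mk ((TensorProduct.comm k X Y).toLinearMap ∘ₗ m.left ∘ₗ (TensorProduct.comm k Y X).toLinearMap)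
    ((TensorProduct.comm k X Y).toLinearMap ∘ₗ m.right ∘ₗ (TensorProduct.comm k Y X).toLinearMap)
    (by
      intro u v
      have h := congrArg (TensorProduct.comm k X Y)
        (m.right_mul_eq (TensorProduct.comm k Y X u) (TensorProduct.comm k Y X v))
      rw [comm_mul, comm_mul] at h
      have e : ∀ w : Y ⊗[k] X, TensorProduct.comm k X Y (TensorProduct.comm k Y X w) = w :=
        fun w => (TensorProduct.comm k Y X).symm_apply_apply w
      rw [e, e] at h
      exact h)

end Multiplier

/-- The product of `A` is nondegenerate. -/
def Nondegenerate (A : Type*) [NonUnitalRing A] : Prop :=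
  (∀ a : A, (∀ b : A, a * b = 0) → a = 0) ∧ (∀ a : A, (∀ b : A, b * a = 0) → a = 0)

end Multipliers

section Hopf

/-- A multiplier Hopf algebra structure on an algebra `Q` with nondegenerate product: a
homomorphism `Δ : Q → M(Q ⊗ Q)` such that `Δ(x)(1 ⊗ y)` and `(x ⊗ 1)Δ(y)` lie in `Q ⊗ Q`
(they are the values of `T₁` and `T₂`, which are thereby determined by `Δ`), which is
coassociative, and for which `T₁` and `T₂` are bijective. -/
structure MultiplierHopfAlgebra (k Q : Type*) [Field k] [NonUnitalRing Q] [Module k Q]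
    [IsScalarTower k Q Q] [SMulCommClass k Q Q] where
  nondegenerate : Nondegenerate Q
  /-- the comultiplication `Δ` -/
  comul : Q →ₙₐ[k] Multiplier k (Q ⊗[k] Q)
  /-- `T₁(x ⊗ y) = Δ(x)(1 ⊗ y)` -/
  T₁ : Q ⊗[k] Q →ₗ[k] Q ⊗[k] Q
  /-- `T₂(x ⊗ y) = (x ⊗ 1)Δ(y)` -/
  T₂ : Q ⊗[k] Q →ₗ[k] Q ⊗[k] Q
  T₁_spec : ∀ x y : Q, Multiplier.ofAlg (T₁ (x ⊗ₜ y))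
    = comul x * Multiplier.tmul (1 : Multiplier k Q) (Multiplier.ofAlg y)
  T₂_spec : ∀ x y : Q, Multiplier.ofAlg (T₂ (x ⊗ₜ y))
    = Multiplier.tmul (Multiplier.ofAlg x) (1 : Multiplier k Q) * comul y
  /-- `(T₂ ⊗ id)(id ⊗ T₁) = (id ⊗ T₁)(T₂ ⊗ id)` on `Q ⊗ Q ⊗ Q` -/
  coassoc : ∀ x y z : Q,
    TensorProduct.assoc k Q Q Q (T₂.rTensor Q
        ((TensorProduct.assoc k Q Q Q).symm (x ⊗ₜ T₁ (y ⊗ₜ z))))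
      = T₁.lTensor Q (TensorProduct.assoc k Q Q Q (T₂ (x ⊗ₜ y) ⊗ₜ z))
  T₁_bijective : Function.Bijective T₁
  T₂_bijective : Function.Bijective T₂

/-- A regular multiplier Hopf algebra: `(Q, Δ)` and `(Q, τΔ)`, with `τ` the flip, are both
multiplier Hopf algebras. -/
structure RegularMultiplierHopfAlgebra (k Q : Type*) [Field k] [NonUnitalRing Q] [Module k Q]
    [IsScalarTower k Q Q] [SMulCommClass k Q Q] extends MultiplierHopfAlgebra k Q where
  cop : MultiplierHopfAlgebra k Q
  cop_comul : ∀ x : Q, cop.comul x = (comul x).flip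

namespace MultiplierHopfAlgebra

variable {k Q : Type*} [Field k] [NonUnitalRing Q] [Module k Q]
    [IsScalarTower k Q Q] [SMulCommClass k Q Q] (H : MultiplierHopfAlgebra k Q)

/-- `(ε ⊗ id)(Δ(x)(1 ⊗ y)) = x y` and `(id ⊗ ε)((x ⊗ 1)Δ(y)) = x y`. -/
def IsCounit (ε : Q →ₗ[k] k) : Prop :=
  (∀ x y : Q, TensorProduct.lid k Q (ε.rTensor Q (H.T₁ (x ⊗ₜ y))) = x * y) ∧
  (∀ x y : Q, TensorProduct.rid k Q (ε.lTensor Q (H.T₂ (x ⊗ₜ y))) = x * y)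

/-- The counit: the unique linear form with `IsCounit`. -/
noncomputable def counit : Q →ₗ[k] k := Classical.epsilon H.IsCounit

/-- `m(S ⊗ id)(Δ(x)(1 ⊗ y)) = ε(x) y` and `m(id ⊗ S)((x ⊗ 1)Δ(y)) = ε(y) x`. -/
def IsAntipode (S : Q →ₗ[k] Q) : Prop :=
  (∀ x y : Q, LinearMap.mul' k Q (S.rTensor Q (H.T₁ (x ⊗ₜ y))) = H.counit x • y) ∧
  (∀ x y : Q, LinearMap.mul' k Q (S.lTensor Q (H.T₂ (x ⊗ₜ y))) = H.counit y • x)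

/-- The antipode `S`: the unique linear map with `IsAntipode`. -/
noncomputable def antipode : Q →ₗ[k] Q := Classical.epsilon H.IsAntipode

/-- The inverse `S⁻¹` of the antipode (as a linear endomorphism; it exists for regular `Q`). -/
noncomputable def antipodeInv : Q →ₗ[k] Q :=
  Ring.inverse (M₀ := Module.End k Q) H.antipode

end MultiplierHopfAlgebra

end Hopf

section Actions

variable {k Q : Type*} [Field k] [NonUnitalRing Q] [Module k Q]
    [IsScalarTower k Q Q] [SMulCommClass k Q Q]

/-- `A` is a `Q`-bimodule algebra: a unital left and a unital right `Q`-module, with commuting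
actions, that is a left and a right `Q`-module algebra. The module algebra laws
`x ▷ (a b) = ∑ (x₁ ▷ a)(x₂ ▷ b)` and `(a b) ◁ x = ∑ (a ◁ x₁)(b ◁ x₂)` are stated for `a = y ▷ a'`,
`b = z ▷ b'` (such elements span `A`), where `Δ(x)` is covered: `Δ(x)(y ⊗ z)` is in `Q ⊗ Q`. -/
structure BimoduleAlgebra (H : MultiplierHopfAlgebra k Q) (A : Type*) [NonUnitalRing A]
    [Module k A] [IsScalarTower k A A] [SMulCommClass k A A] where
  /-- `lact x a = x ▷ a` -/
  lact : Q →ₗ[k] A →ₗ[k] A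
  /-- `ract a x = a ◁ x` -/
  ract : A →ₗ[k] Q →ₗ[k] A
  mul_lact : ∀ (x y : Q) (a : A), lact (x * y) a = lact x (lact y a)
  ract_mul : ∀ (a : A) (x y : Q), ract a (x * y) = ract (ract a x) y
  /-- `Q ▷ A = A` -/
  lact_unital : Submodule.span k {c : A | ∃ (x : Q) (a : A), lact x a = c} = ⊤
  /-- `A ◁ Q = A` -/
  ract_unital : Submodule.span k {c : A | ∃ (a : A) (x : Q), ract a x = c} = ⊤
  lact_ract : ∀ (x : Q) (a : A) (y : Q), ract (lact x a) y = lact x (ract a y)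
  lact_algebra : ∀ (x y z : Q) (a b : A), lact x (lact y a * lact z b)
    = LinearMap.mul' k A
        (TensorProduct.map (lact.flip a) (lact.flip b) ((H.comul x).left (y ⊗ₜ z)))
  ract_algebra : ∀ (x y z : Q) (a b : A), ract (ract a y * ract b z) x
    = LinearMap.mul' k A
        (TensorProduct.map (ract a) (ract b) ((H.comul x).right (y ⊗ₜ z)))

/-- `B`, an algebra with nondegenerate product, is a left `Q`-comodule algebra with coaction `Γ : B → M(Q ⊗ B)`, an injective homomorphism
such that `Γ(b)(x ⊗ 1)` and `(x ⊗ 1)Γ(b)` lie in `Q ⊗ B` (they are the values of `Γ₁` and `Γ₂`,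
which are thereby determined by `Γ`), and `(id ⊗ Γ)Γ = (Δ ⊗ id)Γ`. -/
structure LeftComoduleAlgebra (H : MultiplierHopfAlgebra k Q) (B : Type*) [NonUnitalRing B]
    [Module k B] [IsScalarTower k B B] [SMulCommClass k B B] where
  nondegenerate : Nondegenerate B
  /-- the coaction -/
  Γ : B →ₙₐ[k] Multiplier k (Q ⊗[k] B)
  Γ_injective : Function.Injective Γ
  /-- `Γ₁ b x = Γ(b)(x ⊗ 1)` -/
  Γ₁ : B →ₗ[k] Q →ₗ[k] Q ⊗[k] B
  /-- `Γ₂ x b = (x ⊗ 1)Γ(b)` -/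
  Γ₂ : Q →ₗ[k] B →ₗ[k] Q ⊗[k] B
  Γ₁_spec : ∀ (b : B) (x : Q), Multiplier.ofAlg (Γ₁ b x)
    = Γ b * Multiplier.tmul (Multiplier.ofAlg x) (1 : Multiplier k B)
  Γ₂_spec : ∀ (x : Q) (b : B), Multiplier.ofAlg (Γ₂ x b)
    = Multiplier.tmul (Multiplier.ofAlg x) (1 : Multiplier k B) * Γ b
  /-- `(id ⊗ Γ)Γ(b) = (Δ ⊗ id)Γ(b)`, multiplied by `x ⊗ 1 ⊗ 1` on the left and by `Δ(y) ⊗ 1` on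
  the right, which brings both sides into `Q ⊗ Q ⊗ B` and determines them. The left side is then
  `(id ⊗ Γ)((x ⊗ 1)Γ(b)) (Δ(y) ⊗ 1)`, where `p ⊗ c` in `(x ⊗ 1)Γ(b)` contributes
  `∑ u ⊗ Γ(c)(v ⊗ 1)` with `∑ u ⊗ v = (p ⊗ 1)Δ(y)`; the right side is
  `(x ⊗ 1 ⊗ 1)(Δ ⊗ id)(Γ(b)(y ⊗ 1))`. -/
  Γ_coassoc : ∀ (x y : Q) (b : B),
    (TensorProduct.lift Γ₁.flip).lTensor Q (TensorProduct.assoc k Q Q B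
        ((H.T₂ ∘ₗ (TensorProduct.mk k Q Q).flip y).rTensor B (Γ₂ x b)))
      = TensorProduct.assoc k Q Q B
          ((H.T₂ ∘ₗ TensorProduct.mk k Q Q x).rTensor B (Γ₁ b y))

/-- `B`, an algebra with nondegenerate product, is a right `Q`-comodule algebra with coaction `Υ : B → M(B ⊗ Q)`, an injective homomorphism
such that `Υ(b)(1 ⊗ x)` and `(1 ⊗ x)Υ(b)` lie in `B ⊗ Q` (they are the values of `Υ₁` and `Υ₂`,
which are thereby determined by `Υ`), and `(Υ ⊗ id)Υ = (id ⊗ Δ)Υ`. -/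
structure RightComoduleAlgebra (H : MultiplierHopfAlgebra k Q) (B : Type*) [NonUnitalRing B]
    [Module k B] [IsScalarTower k B B] [SMulCommClass k B B] where
  nondegenerate : Nondegenerate B
  /-- the coaction -/
  Υ : B →ₙₐ[k] Multiplier k (B ⊗[k] Q)
  Υ_injective : Function.Injective Υ
  /-- `Υ₁ b x = Υ(b)(1 ⊗ x)` -/
  Υ₁ : B →ₗ[k] Q →ₗ[k] B ⊗[k] Q
  /-- `Υ₂ x b = (1 ⊗ x)Υ(b)` -/
  Υ₂ : Q →ₗ[k] B →ₗ[k] B ⊗[k] Q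
  Υ₁_spec : ∀ (b : B) (x : Q), Multiplier.ofAlg (Υ₁ b x)
    = Υ b * Multiplier.tmul (1 : Multiplier k B) (Multiplier.ofAlg x)
  Υ₂_spec : ∀ (x : Q) (b : B), Multiplier.ofAlg (Υ₂ x b)
    = Multiplier.tmul (1 : Multiplier k B) (Multiplier.ofAlg x) * Υ b
  /-- `(Υ ⊗ id)Υ(b) = (id ⊗ Δ)Υ(b)`, multiplied by `1 ⊗ 1 ⊗ x` on the right and by `1 ⊗ Δ(y)` on
  the left, which brings both sides into `B ⊗ Q ⊗ Q` and determines them. The left side is then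
  `(1 ⊗ Δ(y)) (Υ ⊗ id)(Υ(b)(1 ⊗ x))`, where `c ⊗ q` in `Υ(b)(1 ⊗ x)` contributes
  `∑ (1 ⊗ u)Υ(c) ⊗ v` with `∑ u ⊗ v = Δ(y)(1 ⊗ q)`; the right side is
  `(id ⊗ Δ)((1 ⊗ y)Υ(b)) (1 ⊗ 1 ⊗ x)`. -/
  Υ_coassoc : ∀ (x y : Q) (b : B),
    (TensorProduct.lift Υ₂.flip).rTensor Q ((TensorProduct.assoc k B Q Q).symm
        ((H.T₁ ∘ₗ TensorProduct.mk k Q Q y).lTensor B (Υ₁ b x)))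
      = (TensorProduct.assoc k B Q Q).symm
          ((H.T₁ ∘ₗ (TensorProduct.mk k Q Q).flip x).lTensor B (Υ₂ y b))

/-- `B` is a `Q`-bicomodule algebra: an algebra with nondegenerate product that is a left and a
right `Q`-comodule algebra, with
`(1 ⊗ 1 ⊗ x)((id ⊗ Υ)(Γ(b)(y ⊗ 1))) = ((Γ ⊗ id)((1 ⊗ x)Υ(b)))(y ⊗ 1 ⊗ 1)`. -/
structure BicomoduleAlgebra (H : MultiplierHopfAlgebra k Q) (B : Type*) [NonUnitalRing B]
    [Module k B] [IsScalarTower k B B] [SMulCommClass k B B] extends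
    LeftComoduleAlgebra H B, RightComoduleAlgebra H B where
  compat : ∀ (x y : Q) (b : B),
    (Υ₂ x).lTensor Q (Γ₁ b y)
      = TensorProduct.assoc k Q B Q ((Γ₁.flip y).rTensor Q (Υ₂ x b))

end Actions

section TwistedProducts

/-- The multiplication `(x # y)(x' # y') = x_T x'_R # y_R y'_T` of the generalized L-R-twisted
tensor product of `X` and `Y`, where `R(y ⊗ x') = x'_R ⊗ y_R` and `T(x ⊗ y') = x_T ⊗ y'_T`. -/
noncomputable def twistedMul {k X Y : Type*} [Field k]
    [NonUnitalRing X] [Module k X] [IsScalarTower k X X] [SMulCommClass k X X]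
    [NonUnitalRing Y] [Module k Y] [IsScalarTower k Y Y] [SMulCommClass k Y Y]
    (R : Y ⊗[k] X →ₗ[k] X ⊗[k] Y) (T : X ⊗[k] Y →ₗ[k] X ⊗[k] Y) :
    X ⊗[k] Y →ₗ[k] X ⊗[k] Y →ₗ[k] X ⊗[k] Y :=
  TensorProduct.curry
    (TensorProduct.lift (TensorProduct.map₂ (LinearMap.mul k X).flip (LinearMap.mul k Y)) ∘ₗ
      TensorProduct.map R T ∘ₗ
      (TensorProduct.tensorTensorTensorComm k Y X X Y).toLinearMap ∘ₗ
      (TensorProduct.comm k X Y).toLinearMap.rTensor (X ⊗[k] Y))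

/-- With `R(y ⊗ x') = p ⊗ q` and `T(x ⊗ y') = r ⊗ s` the product is `r p # q s`. -/
theorem twistedMul_tmul {k X Y : Type*} [Field k]
    [NonUnitalRing X] [Module k X] [IsScalarTower k X X] [SMulCommClass k X X]
    [NonUnitalRing Y] [Module k Y] [IsScalarTower k Y Y] [SMulCommClass k Y Y]
    (R : Y ⊗[k] X →ₗ[k] X ⊗[k] Y) (T : X ⊗[k] Y →ₗ[k] X ⊗[k] Y) (x x' : X) (y y' : Y) :
    twistedMul R T (x ⊗ₜ y) (x' ⊗ₜ y')
      = TensorProduct.map₂ (LinearMap.mul k X).flip (LinearMap.mul k Y)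
          (R (y ⊗ₜ x')) (T (x ⊗ₜ y')) := by
  simp [twistedMul]

variable {k Q A B : Type*} [Field k]
  [NonUnitalRing Q] [Module k Q] [IsScalarTower k Q Q] [SMulCommClass k Q Q]
  [NonUnitalRing A] [Module k A] [IsScalarTower k A A] [SMulCommClass k A A]
  [NonUnitalRing B] [Module k B] [IsScalarTower k B B] [SMulCommClass k B B]
  {H : MultiplierHopfAlgebra k Q} (MA : BimoduleAlgebra H A) (MB : BicomoduleAlgebra H B)

/-- `F` is the map `b ⊗ a ↦ ∑ b₀ ⊗ (b₍₋₁₎ ▷ a)`. For `a = x ▷ a'` the coaction is covered: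
`∑ b₀ ⊗ (b₍₋₁₎ x ▷ a')`, with `∑ b₍₋₁₎ x ⊗ b₀ = Γ(b)(x ⊗ 1)`. -/
def IsLeftTwist (F : B ⊗[k] A →ₗ[k] B ⊗[k] A) : Prop :=
  ∀ (b : B) (x : Q) (a : A), F (b ⊗ₜ MA.lact x a)
    = (MA.lact.flip a).lTensor B (TensorProduct.comm k Q B (MB.Γ₁ b x))

/-- `F` is the map `a ⊗ b ↦ ∑ b₀ ⊗ (a ◁ b₍₁₎)`. For `a = a' ◁ x` the coaction is covered:
`∑ b₀ ⊗ (a' ◁ x b₍₁₎)`, with `∑ b₀ ⊗ x b₍₁₎ = (1 ⊗ x)Υ(b)`. -/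
def IsRightTwist (F : A ⊗[k] B →ₗ[k] B ⊗[k] A) : Prop :=
  ∀ (a : A) (x : Q) (b : B), F (MA.ract a x ⊗ₜ b)
    = (MA.ract a).lTensor B (MB.Υ₂ x b)

/-- `F` is the map `b ⊗ a ↦ ∑ b₀ ⊗ (S⁻¹(b₍₋₁₎) ▷ a)`. For `a = S⁻¹(x) ▷ a'` the coaction is
covered: `∑ b₀ ⊗ (S⁻¹(x b₍₋₁₎) ▷ a')`, with `∑ x b₍₋₁₎ ⊗ b₀ = (x ⊗ 1)Γ(b)`. -/
def IsLeftTwistInv (F : B ⊗[k] A →ₗ[k] B ⊗[k] A) : Prop :=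
  ∀ (b : B) (x : Q) (a : A), F (b ⊗ₜ MA.lact (H.antipodeInv x) a)
    = (MA.lact.flip a ∘ₗ H.antipodeInv).lTensor B (TensorProduct.comm k Q B (MB.Γ₂ x b))

/-- `F` is the map `a ⊗ b ↦ ∑ b₀ ⊗ (a ◁ S⁻¹(b₍₁₎))`. For `a = a' ◁ S⁻¹(x)` the coaction is
covered: `∑ b₀ ⊗ (a' ◁ S⁻¹(b₍₁₎ x))`, with `∑ b₀ ⊗ b₍₁₎ x = Υ(b)(1 ⊗ x)`. -/
def IsRightTwistInv (F : A ⊗[k] B →ₗ[k] B ⊗[k] A) : Prop :=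
  ∀ (a : A) (x : Q) (b : B), F (MA.ract a (H.antipodeInv x) ⊗ₜ b)
    = (MA.ract a ∘ₗ H.antipodeInv).lTensor B (MB.Υ₁ b x)

/-- `b ⊗ a ↦ ∑ b₀ ⊗ (b₍₋₁₎ ▷ a)` -/
noncomputable def leftTwist : B ⊗[k] A →ₗ[k] B ⊗[k] A :=
  Classical.epsilon (IsLeftTwist MA MB)

/-- `a ⊗ b ↦ ∑ b₀ ⊗ (a ◁ b₍₁₎)` -/
noncomputable def rightTwist : A ⊗[k] B →ₗ[k] B ⊗[k] A :=
  Classical.epsilon (IsRightTwist MA MB)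

/-- `b ⊗ a ↦ ∑ b₀ ⊗ (S⁻¹(b₍₋₁₎) ▷ a)` -/
noncomputable def leftTwistInv : B ⊗[k] A →ₗ[k] B ⊗[k] A :=
  Classical.epsilon (IsLeftTwistInv MA MB)

/-- `a ⊗ b ↦ ∑ b₀ ⊗ (a ◁ S⁻¹(b₍₁₎))` -/
noncomputable def rightTwistInv : A ⊗[k] B →ₗ[k] B ⊗[k] A :=
  Classical.epsilon (IsRightTwistInv MA MB)

/-- The multiplication of the generalized L-R-smash product `B ⋄_r A` on `B ⊗ A`:
`(b' ⋄ a')(b ⋄ a) = ∑ b'₀ b₀ ⋄ (a' ◁ b₍₁₎)(b'₍₋₁₎ ▷ a)`. -/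
noncomputable def lrSmashMulR : B ⊗[k] A →ₗ[k] B ⊗[k] A →ₗ[k] B ⊗[k] A :=
  twistedMul (rightTwist MA MB) (leftTwist MA MB)

/-- The multiplication of the generalized L-R-smash product `A ⋄_l B` on `A ⊗ B`:
`(a ⋄ b)(a' ⋄ b') = ∑ (a ◁ b'₍₁₎)(b₍₋₁₎ ▷ a') ⋄ b₀ b'₀`. -/
noncomputable def lrSmashMulL : A ⊗[k] B →ₗ[k] A ⊗[k] B →ₗ[k] A ⊗[k] B :=
  twistedMul
    ((TensorProduct.comm k B A).toLinearMap ∘ₗ leftTwist MA MB)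
    ((TensorProduct.comm k B A).toLinearMap ∘ₗ rightTwist MA MB)

/-- The multiplication of the generalized twisted smash product `B ⋆_r A` on `B ⊗ A`:
`(b' ⋆ a')(b ⋆ a) = ∑ b' b₀ ⋆ (S⁻¹(b₍₋₁₎) ▷ a' ◁ b₍₁₎) a`, that is, the twisted tensor product
for `a' ⊗ b ↦ ∑ b₀ ⊗ (S⁻¹(b₍₋₁₎) ▷ a' ◁ b₍₁₎)`, where
`∑ b₍₋₁₎ ⊗ b₀ ⊗ b₍₁₎` stands for `(Γ ⊗ id)Υ(b)`. -/
noncomputable def twistedSmashMulR : B ⊗[k] A →ₗ[k] B ⊗[k] A →ₗ[k] B ⊗[k] A :=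
  twistedMul (leftTwistInv MA MB ∘ₗ rightTwist MA MB) LinearMap.id

/-- The multiplication of the generalized twisted smash product `A ⋆_l B` on `A ⊗ B`:
`(a ⋆ b)(a' ⋆ b') = ∑ a (b₍₋₁₎ ▷ a' ◁ S⁻¹(b₍₁₎)) ⋆ b₀ b'`, that is, the twisted tensor product
for `b ⊗ a' ↦ ∑ (b₍₋₁₎ ▷ a' ◁ S⁻¹(b₍₁₎)) ⊗ b₀`, where
`∑ b₍₋₁₎ ⊗ b₀ ⊗ b₍₁₎` stands for `(id ⊗ Υ)Γ(b)`. -/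
noncomputable def twistedSmashMulL : A ⊗[k] B →ₗ[k] A ⊗[k] B →ₗ[k] A ⊗[k] B :=
  twistedMul
    ((TensorProduct.comm k B A).toLinearMap ∘ₗ rightTwistInv MA MB ∘ₗ
      (TensorProduct.comm k B A).toLinearMap ∘ₗ leftTwist MA MB)
    LinearMap.id

end TwistedProducts

end MultHopf

/-!
The four products are twisted tensor products: `⋄` is built from a pair of maps `R`, `T`, and `⋆`
from the pair `T⁻¹ R`, `id`. For the first isomorphism `T` is the left twist
`λ(b ⊗ a) = ∑ b₀ ⊗ (b₍₋₁₎ ▷ a)` and `R` is the right twist `ρ(a ⊗ b) = ∑ b₀ ⊗ (a ◁ b₍₁₎)`; for the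
second one they exchange roles. In both cases the isomorphism is `T` itself, and `map_twistedMul`
shows that a bijective `T` is multiplicative as soon as

* `T` is multiplicative in each of its two variables (`IsTwist.mul_tmul`, `IsTwist.tmul_mul`), which
  expresses that `Γ` is a homomorphism, that `A` is a module algebra and that `Γ` is coassociative;
* `R` and `T` commute, both when they share the element of `B` (`twist_comm_of_coaction`, from the
  compatibility of the two coactions) and when they share the element of `A`
  (`twist_comm_of_action`, from the commuting actions).

The inverse of `λ` is `b ⊗ a ↦ ∑ b₀ ⊗ (S⁻¹(b₍₋₁₎) ▷ a)`; this rests on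
`∑ S(b₍₋₂₎ s) b₍₋₁₎ ⊗ b₀ = S(s) ⊗ b` and `∑ b₍₋₁₎ S⁻¹(x b₍₋₂₎) ⊗ b₀ = S⁻¹(x) ⊗ b`
(`CoactionMaps.Γ₂_antipode_Γ₁`, `CoactionMaps.Γ₁_antipodeInv_Γ₂`), hence on the counit law of the
coaction, which follows from coassociativity and the injectivity of `Γ`.

That the twists are well defined needs local units in `Q` (`IsCop.exists_mul_eq_self`): a map on
`Q ⊗ A` that is balanced over `Q` then factors through the action
(`exists_linearMap_of_balanced`). Local units, the counit, and the antipode with its bijectivity are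
derived from the bijectivity of `T₁` and `T₂` and from coassociativity, as in Van Daele's theory of
multiplier Hopf algebras; the antipode takes values in `Q` and not just in `M(Q)` because `(Q, τΔ)`
is a multiplier Hopf algebra as well.

To treat left and right at once, the statements about coactions are proved for bilinear data
(`HopfMaps`, `CoactionMaps`, `ModuleMaps`) in which the products are not instances. The right twist
is the left twist for the opposite algebras and the opposite, co-opposite Hopf structure.
-/

namespace MultHopf

/-! ### Separation of elements of tensor products -/

section Separation

variable {k V W X : Type*} [Field k] [AddCommGroup V] [Module k V] [AddCommGroup W] [Module k W]
  [AddCommGroup X] [Module k X]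

theorem tensor_eq_zero_of_lTensor (u : V ⊗[k] W) (h : ∀ φ : W →ₗ[k] k, φ.lTensor V u = 0) :
    u = 0 := by
  let b := Module.Free.chooseBasis k W
  apply (TensorProduct.equivFinsuppOfBasisRight (M := V) b).injective
  ext i
  simp [TensorProduct.equivFinsuppOfBasisRight_apply, h]

theorem rTensor_lTensor_comm {V' W' : Type*} [AddCommGroup V'] [Module k V'] [AddCommGroup W']
    [Module k W'] (f : V →ₗ[k] V') (g : W →ₗ[k] W') (u : V ⊗[k] W) :
    f.rTensor W' (g.lTensor V u) = g.lTensor V' (f.rTensor W u) := by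
  rw [← LinearMap.comp_apply, ← LinearMap.comp_apply, LinearMap.rTensor_comp_lTensor,
    LinearMap.lTensor_comp_rTensor]

/-- A jointly injective family of linear maps stays jointly injective after tensoring. -/
theorem tensor_eq_zero_of_rTensor {ι : Type*} (f : ι → V →ₗ[k] X)
    (hf : ∀ v, (∀ i, f i v = 0) → v = 0) (u : V ⊗[k] W) (h : ∀ i, (f i).rTensor W u = 0) :
    u = 0 := by
  refine tensor_eq_zero_of_lTensor u fun φ => ?_
  apply (TensorProduct.rid k V).injective
  rw [map_zero]
  refine hf _ fun i => ?_
  have h1 : ∀ w : V ⊗[k] k, f i (TensorProduct.rid k V w)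
      = TensorProduct.rid k X ((f i).rTensor k w) := by
    intro w
    induction w using TensorProduct.induction_on with
    | zero => simp
    | add a b ha hb => simp only [map_add, ha, hb]
    | tmul a b => simp
  rw [h1, rTensor_lTensor_comm, h i]
  simp

theorem tensor_eq_zero_of_lTensor_family {ι : Type*} (f : ι → V →ₗ[k] X)
    (hf : ∀ v, (∀ i, f i v = 0) → v = 0) (u : W ⊗[k] V) (h : ∀ i, (f i).lTensor W u = 0) :
    u = 0 := by
  apply (TensorProduct.comm k W V).injective
  rw [map_zero]
  refine tensor_eq_zero_of_rTensor f hf _ fun i => ?_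
  rw [← LinearMap.comm_comp_lTensor_comp_comm_eq]
  simp [h i]

end Separation

/-! ### Nondegenerate products and multipliers -/

section Nondegenerate

variable {k X Y : Type*} [Field k]
  [NonUnitalRing X] [Module k X] [IsScalarTower k X X] [SMulCommClass k X X]
  [NonUnitalRing Y] [Module k Y] [IsScalarTower k Y Y] [SMulCommClass k Y Y]

theorem tmul_mul_eq (x : X) (y : Y) (v : X ⊗[k] Y) :
    (x ⊗ₜ[k] y) * v = (LinearMap.mulLeft k x).rTensor Y ((LinearMap.mulLeft k y).lTensor X v) := by
  induction v using TensorProduct.induction_on with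
  | zero => simp
  | add a b ha hb => simp only [mul_add, map_add, ha, hb]
  | tmul a b => simp

theorem mul_tmul_eq (x : X) (y : Y) (v : X ⊗[k] Y) :
    v * (x ⊗ₜ[k] y)
      = (LinearMap.mulRight k x).rTensor Y ((LinearMap.mulRight k y).lTensor X v) := by
  induction v using TensorProduct.induction_on with
  | zero => simp
  | add a b ha hb => simp only [add_mul, map_add, ha, hb]
  | tmul a b => simp

/-- The tensor product of two algebras with nondegenerate products has nondegenerate product. -/
theorem Nondegenerate.tensor (hX : Nondegenerate X) (hY : Nondegenerate Y) :
    Nondegenerate (X ⊗[k] Y) := by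
  constructor
  · intro u hu
    refine tensor_eq_zero_of_lTensor_family (fun y : Y => LinearMap.mulRight k y)
      (fun v hv => hY.1 v fun b => hv b) u fun y => ?_
    refine tensor_eq_zero_of_rTensor (fun x : X => LinearMap.mulRight k x)
      (fun v hv => hX.1 v fun b => hv b) _ fun x => ?_
    rw [← mul_tmul_eq, hu]
  · intro u hu
    refine tensor_eq_zero_of_lTensor_family (fun y : Y => LinearMap.mulLeft k y)
      (fun v hv => hY.2 v fun b => hv b) u fun y => ?_
    refine tensor_eq_zero_of_rTensor (fun x : X => LinearMap.mulLeft k x)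
      (fun v hv => hX.2 v fun b => hv b) _ fun x => ?_
    rw [← tmul_mul_eq, hu]

theorem Nondegenerate.eq_of_mul_right (hX : Nondegenerate X) {a b : X}
    (h : ∀ c, a * c = b * c) : a = b :=
  sub_eq_zero.1 (hX.1 _ fun c => by rw [sub_mul, h, sub_self])

theorem Nondegenerate.eq_of_mul_left (hX : Nondegenerate X) {a b : X}
    (h : ∀ c, c * a = c * b) : a = b :=
  sub_eq_zero.1 (hX.2 _ fun c => by rw [mul_sub, h, sub_self])

namespace Multiplier

theorem left_mul (m n : Multiplier k X) (a : X) : (m * n).left a = m.left (n.left a) := rfl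

theorem right_mul (m n : Multiplier k X) (a : X) : (m * n).right a = n.right (m.right a) := rfl

theorem left_mul_assoc (hX : Nondegenerate X) (m : Multiplier k X) (a b : X) :
    m.left (a * b) = m.left a * b :=
  hX.eq_of_mul_left fun c => by
    rw [← mul_assoc, ← right_mul_eq, ← right_mul_eq, mul_assoc]

theorem ext_left (hX : Nondegenerate X) {m n : Multiplier k X}
    (h : ∀ a, m.left a = n.left a) : m = n := by
  apply Subtype.ext
  refine Prod.ext (LinearMap.ext h) (MulOpposite.unop_injective (LinearMap.ext fun a => ?_))
  exact hX.eq_of_mul_right fun b => by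
    change m.right a * b = n.right a * b
    rw [right_mul_eq, right_mul_eq, h]

theorem left_tmul_one (x : X) (v : X ⊗[k] Y) :
    (tmul (ofAlg x) (1 : Multiplier k Y)).left v = (LinearMap.mulLeft k x).rTensor Y v := rfl

theorem left_one_tmul (y : Y) (v : X ⊗[k] Y) :
    (tmul (1 : Multiplier k X) (ofAlg y)).left v = (LinearMap.mulLeft k y).lTensor X v := rfl

theorem left_ofAlg (a b : X) : (ofAlg a : Multiplier k X).left b = a * b := rfl

theorem right_ofAlg (a b : X) : (ofAlg a : Multiplier k X).right b = b * a := rfl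

theorem right_one_tmul (y : Y) (v : X ⊗[k] Y) :
    (tmul (1 : Multiplier k X) (ofAlg y)).right v = (LinearMap.mulRight k y).lTensor X v := rfl

theorem left_flip (m : Multiplier k (X ⊗[k] Y)) (v : Y ⊗[k] X) :
    m.flip.left v = TensorProduct.comm k X Y (m.left (TensorProduct.comm k Y X v)) := rfl

theorem flip_flip (m : Multiplier k (X ⊗[k] Y)) : m.flip.flip = m := by
  apply Subtype.ext
  refine Prod.ext (LinearMap.ext fun a => ?_)
    (MulOpposite.unop_injective (LinearMap.ext fun a => ?_))
  · change m.flip.flip.left a = m.left a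
    simp [left_flip, TensorProduct.comm_comm]
  · change TensorProduct.comm k Y X (TensorProduct.comm k X Y
      (m.right (TensorProduct.comm k Y X (TensorProduct.comm k X Y a)))) = m.right a
    simp [TensorProduct.comm_comm]

end Multiplier

/-- Multiplication by `x ⊗ 1` on the left is compatible with the product of `X ⊗ Y`. -/
theorem rTensor_mulLeft_mul (x : X) (u v : X ⊗[k] Y) :
    (LinearMap.mulLeft k x).rTensor Y u * v = (LinearMap.mulLeft k x).rTensor Y (u * v) := by
  induction u using TensorProduct.induction_on with
  | zero => simp
  | add a b ha hb => simp only [add_mul, map_add, ha, hb]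
  | tmul a b =>
    rw [LinearMap.rTensor_tmul, tmul_mul_eq, tmul_mul_eq]
    simp only [LinearMap.mulLeft_apply, LinearMap.mulLeft_mul, LinearMap.rTensor_comp,
      LinearMap.comp_apply]

theorem lTensor_mulLeft_mul (y : Y) (u v : X ⊗[k] Y) :
    (LinearMap.mulLeft k y).lTensor X u * v = (LinearMap.mulLeft k y).lTensor X (u * v) := by
  induction u using TensorProduct.induction_on with
  | zero => simp
  | add a b ha hb => simp only [add_mul, map_add, ha, hb]
  | tmul a b =>
    rw [LinearMap.lTensor_tmul, tmul_mul_eq, tmul_mul_eq, ← rTensor_lTensor_comm]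
    simp only [LinearMap.mulLeft_apply, LinearMap.mulLeft_mul, LinearMap.lTensor_comp,
      LinearMap.comp_apply]

theorem rTensor_mulRight_mul (x : X) (u v : X ⊗[k] Y) :
    (LinearMap.mulRight k x).rTensor Y u * v = u * (LinearMap.mulLeft k x).rTensor Y v := by
  induction u using TensorProduct.induction_on with
  | zero => simp
  | add a b ha hb => simp only [add_mul, map_add, ha, hb]
  | tmul a b =>
    rw [LinearMap.rTensor_tmul, tmul_mul_eq, tmul_mul_eq, ← rTensor_lTensor_comm]
    simp only [LinearMap.mulRight_apply, LinearMap.mulLeft_mul, LinearMap.rTensor_comp,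
      LinearMap.comp_apply]

theorem lTensor_mulRight_mul (y : Y) (u v : X ⊗[k] Y) :
    (LinearMap.mulRight k y).lTensor X u * v = u * (LinearMap.mulLeft k y).lTensor X v := by
  induction u using TensorProduct.induction_on with
  | zero => simp
  | add a b ha hb => simp only [add_mul, map_add, ha, hb]
  | tmul a b =>
    rw [LinearMap.lTensor_tmul, tmul_mul_eq, tmul_mul_eq]
    simp only [LinearMap.mulRight_apply, LinearMap.mulLeft_mul, LinearMap.lTensor_comp,
      LinearMap.comp_apply]

end Nondegenerate

/-! ### The maps `T₁` and `T₂` of a multiplier Hopf algebra -/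

namespace MultiplierHopfAlgebra
open Multiplier

variable {k Q : Type*} [Field k] [NonUnitalRing Q] [Module k Q]
    [IsScalarTower k Q Q] [SMulCommClass k Q Q] (H : MultiplierHopfAlgebra k Q)

theorem nondegenerate_tensor (H : MultiplierHopfAlgebra k Q) : Nondegenerate (Q ⊗[k] Q) :=
  H.nondegenerate.tensor H.nondegenerate

/-- `w ↦ Δ(x) w` on `Q ⊗ Q`. -/
def comulLeft (x : Q) : Q ⊗[k] Q →ₗ[k] Q ⊗[k] Q := (H.comul x).left

theorem comulLeft_mul (x y : Q) (w : Q ⊗[k] Q) :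
    H.comulLeft (x * y) w = H.comulLeft x (H.comulLeft y w) := by
  simp only [comulLeft, map_mul, left_mul]

theorem comulLeft_mul_assoc (x : Q) (u v : Q ⊗[k] Q) :
    H.comulLeft x (u * v) = H.comulLeft x u * v :=
  left_mul_assoc H.nondegenerate_tensor _ _ _

theorem T₁_mul (x y : Q) (v : Q ⊗[k] Q) :
    H.T₁ (x ⊗ₜ y) * v = H.comulLeft x ((LinearMap.mulLeft k y).lTensor Q v) := by
  rw [← left_ofAlg (k := k), H.T₁_spec, left_mul, left_one_tmul]; rfl

theorem T₂_mul (x y : Q) (v : Q ⊗[k] Q) :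
    H.T₂ (x ⊗ₜ y) * v = (LinearMap.mulLeft k x).rTensor Q (H.comulLeft y v) := by
  rw [← left_ofAlg (k := k), H.T₂_spec, left_mul, left_tmul_one]; rfl

/-- `(x ⊗ 1)(Δ(y)(1 ⊗ z)) = ((x ⊗ 1)Δ(y))(1 ⊗ z)` -/
theorem mulLeft_T₁ (x y z : Q) :
    (LinearMap.mulLeft k x).rTensor Q (H.T₁ (y ⊗ₜ z))
      = (LinearMap.mulRight k z).lTensor Q (H.T₂ (x ⊗ₜ y)) :=
  H.nondegenerate_tensor.eq_of_mul_right fun v => by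
    rw [rTensor_mulLeft_mul, T₁_mul, lTensor_mulRight_mul, T₂_mul]

theorem T₁_mul_tmul (x y z : Q) : H.T₁ ((x * y) ⊗ₜ z) = H.comulLeft x (H.T₁ (y ⊗ₜ z)) :=
  H.nondegenerate_tensor.eq_of_mul_right fun v => by
    rw [← comulLeft_mul_assoc, T₁_mul, T₁_mul, comulLeft_mul]

theorem T₁_tmul_mul (x y z : Q) :
    H.T₁ (x ⊗ₜ (y * z)) = (LinearMap.mulRight k z).lTensor Q (H.T₁ (x ⊗ₜ y)) :=
  H.nondegenerate_tensor.eq_of_mul_right fun v => by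
    rw [lTensor_mulRight_mul, T₁_mul, T₁_mul, LinearMap.mulLeft_mul, LinearMap.lTensor_comp,
      LinearMap.comp_apply]

/-- `Δ(z)(x ⊗ y) = (Δ(z)(1 ⊗ y))(x ⊗ 1)` -/
theorem comulLeft_tmul (x y z : Q) :
    H.comulLeft z (x ⊗ₜ y) = (LinearMap.mulRight k x).rTensor Q (H.T₁ (z ⊗ₜ y)) :=
  H.nondegenerate_tensor.eq_of_mul_right fun v => by
    rw [rTensor_mulRight_mul, T₁_mul, ← comulLeft_mul_assoc, tmul_mul_eq, rTensor_lTensor_comm]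

/-- `T₂` is a homomorphism of right `Q`-modules for right multiplication by `Δ(x)`. -/
theorem right_T₂ (x y z : Q) : (H.comul x).right (H.T₂ (y ⊗ₜ z)) = H.T₂ (y ⊗ₜ (z * x)) := by
  refine H.nondegenerate_tensor.eq_of_mul_right fun v => ?_
  rw [right_mul_eq, T₂_mul, T₂_mul, comulLeft_mul]; rfl

/-! ### The counit -/

/-- The inverse of `T₁`. -/
noncomputable def T₁Inv : Q ⊗[k] Q →ₗ[k] Q ⊗[k] Q :=
  (LinearEquiv.ofBijective H.T₁ H.T₁_bijective).symm.toLinearMap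

/-- The inverse of `T₂`. -/
noncomputable def T₂Inv : Q ⊗[k] Q →ₗ[k] Q ⊗[k] Q :=
  (LinearEquiv.ofBijective H.T₂ H.T₂_bijective).symm.toLinearMap

@[simp] theorem T₁_T₁Inv (u : Q ⊗[k] Q) : H.T₁ (H.T₁Inv u) = u :=
  (LinearEquiv.ofBijective H.T₁ H.T₁_bijective).apply_symm_apply u

@[simp] theorem T₁Inv_T₁ (u : Q ⊗[k] Q) : H.T₁Inv (H.T₁ u) = u :=
  (LinearEquiv.ofBijective H.T₁ H.T₁_bijective).symm_apply_apply u

@[simp] theorem T₂_T₂Inv (u : Q ⊗[k] Q) : H.T₂ (H.T₂Inv u) = u :=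
  (LinearEquiv.ofBijective H.T₂ H.T₂_bijective).apply_symm_apply u

@[simp] theorem T₂Inv_T₂ (u : Q ⊗[k] Q) : H.T₂Inv (H.T₂ u) = u :=
  (LinearEquiv.ofBijective H.T₂ H.T₂_bijective).symm_apply_apply u

/-- Two linear maps on `Q ⊗ Q` agree as soon as they agree on the values of `T₁`. -/
theorem eq_of_T₁ {V : Type*} [AddCommGroup V] [Module k V] {f g : Q ⊗[k] Q →ₗ[k] V}
    (h : ∀ x y, f (H.T₁ (x ⊗ₜ y)) = g (H.T₁ (x ⊗ₜ y))) (u : Q ⊗[k] Q) : f u = g u := by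
  have h1 : f ∘ₗ H.T₁ = g ∘ₗ H.T₁ := TensorProduct.ext' h
  simpa using LinearMap.congr_fun h1 (H.T₁Inv u)

theorem mul_T₁Inv_tmul (x y c : Q) :
    x ⊗ₜ[k] LinearMap.mul' k Q (H.T₁Inv (y ⊗ₜ c))
      = LinearMap.mul' k Q (H.T₂Inv (x ⊗ₜ y)) ⊗ₜ[k] c := by
  have h1 : ∀ (a : Q) (w : Q ⊗[k] Q),
      (LinearMap.mul' k Q ∘ₗ H.T₁Inv).lTensor Q (TensorProduct.assoc k Q Q Q
        (H.T₂.rTensor Q ((TensorProduct.assoc k Q Q Q).symm (a ⊗ₜ w))))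
      = (LinearMap.mulLeft k a).rTensor Q w := by
    intro a w
    refine H.eq_of_T₁ (f := (LinearMap.mul' k Q ∘ₗ H.T₁Inv).lTensor Q ∘ₗ
      (TensorProduct.assoc k Q Q Q).toLinearMap ∘ₗ H.T₂.rTensor Q ∘ₗ
      (TensorProduct.assoc k Q Q Q).symm.toLinearMap ∘ₗ TensorProduct.mk k Q _ a)
      (fun d e => ?_) w
    change (LinearMap.mul' k Q ∘ₗ H.T₁Inv).lTensor Q (TensorProduct.assoc k Q Q Q
        (H.T₂.rTensor Q ((TensorProduct.assoc k Q Q Q).symm (a ⊗ₜ H.T₁ (d ⊗ₜ e))))) = _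
    rw [H.coassoc, H.mulLeft_T₁, ← LinearMap.comp_apply, ← LinearMap.lTensor_comp]
    have h2 : (LinearMap.mul' k Q ∘ₗ H.T₁Inv) ∘ₗ H.T₁ = LinearMap.mul' k Q := by
      ext; simp
    rw [h2]
    induction H.T₂ (a ⊗ₜ d) using TensorProduct.induction_on with
    | zero => simp
    | add u v hu hv => simp only [TensorProduct.add_tmul, map_add, hu, hv]
    | tmul u v => simp
  have h3 : ∀ u : Q ⊗[k] Q, (LinearMap.mul' k Q ∘ₗ H.T₁Inv).lTensor Q
      (TensorProduct.assoc k Q Q Q (H.T₂ u ⊗ₜ c)) = LinearMap.mul' k Q u ⊗ₜ[k] c := by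
    intro u
    induction u using TensorProduct.induction_on with
    | zero => simp
    | add u v hu hv => simp only [TensorProduct.add_tmul, map_add, hu, hv]
    | tmul a b => simpa using h1 a (b ⊗ₜ c)
  simpa using h3 (H.T₂Inv (x ⊗ₜ y))

theorem exists_isCounit (H : MultiplierHopfAlgebra k Q) : ∃ ε : Q →ₗ[k] k, H.IsCounit ε := by
  rcases subsingleton_or_nontrivial Q with hQ | hQ
  · exact ⟨0, fun x y => Subsingleton.elim _ _, fun x y => Subsingleton.elim _ _⟩
  obtain ⟨x₀, hx₀⟩ := exists_ne (0 : Q)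
  obtain ⟨ψ, hψ⟩ := Module.Projective.exists_dual_eq_one k hx₀
  -- `m T₁⁻¹(y ⊗ c) = ε(y) c` and `m T₂⁻¹(x ⊗ y) = ε(y) x` for a linear form `ε`, because both
  -- sides of `mul_T₁Inv_tmul` separate the variables `x` and `c`.
  let ε : Q →ₗ[k] k := ψ ∘ₗ LinearMap.mul' k Q ∘ₗ H.T₂Inv ∘ₗ TensorProduct.mk k Q Q x₀
  have h1 : ∀ y c, LinearMap.mul' k Q (H.T₁Inv (y ⊗ₜ c)) = ε y • c := by
    intro y c
    have h := congrArg (fun u => TensorProduct.lid k Q (ψ.rTensor Q u)) (H.mul_T₁Inv_tmul x₀ y c)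
    simpa [hψ, ε] using h
  have h2 : ∀ x y, LinearMap.mul' k Q (H.T₂Inv (x ⊗ₜ y)) = ε y • x := by
    intro x y
    have h := congrArg (fun u => TensorProduct.rid k Q (ψ.lTensor Q u)) (H.mul_T₁Inv_tmul x y x₀)
    simpa [hψ, h1] using h.symm
  have h1' : ∀ u, TensorProduct.lid k Q (ε.rTensor Q u) = LinearMap.mul' k Q (H.T₁Inv u) := by
    intro u
    induction u using TensorProduct.induction_on with
    | zero => simp
    | add u v hu hv => simp only [map_add, hu, hv]
    | tmul a b => simp [h1]
  have h2' : ∀ u, TensorProduct.rid k Q (ε.lTensor Q u) = LinearMap.mul' k Q (H.T₂Inv u) := by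
    intro u
    induction u using TensorProduct.induction_on with
    | zero => simp
    | add u v hu hv => simp only [map_add, hu, hv]
    | tmul a b => simp [h2]
  exact ⟨ε, fun x y => by simp [h1'], fun x y => by simp [h2']⟩

theorem isCounit_counit : H.IsCounit H.counit := Classical.epsilon_spec H.exists_isCounit

/-- The first half of `IsCounit` already characterizes the counit. -/
theorem eq_counit {ε : Q →ₗ[k] k}
    (h : ∀ x y : Q, TensorProduct.lid k Q (ε.rTensor Q (H.T₁ (x ⊗ₜ y))) = x * y) :
    ε = H.counit := by
  ext x
  have h1 : ∀ u : Q ⊗[k] Q, ((TensorProduct.lid k Q).toLinearMap ∘ₗ ε.rTensor Q) u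
      = ((TensorProduct.lid k Q).toLinearMap ∘ₗ H.counit.rTensor Q) u :=
    H.eq_of_T₁ fun x y => by
      simp only [LinearMap.comp_apply, LinearEquiv.coe_coe, h, H.isCounit_counit.1]
  rcases subsingleton_or_nontrivial Q with hQ | hQ
  · simp [Subsingleton.elim x 0]
  obtain ⟨c, hc⟩ := exists_ne (0 : Q)
  exact smul_left_injective k hc (by simpa using h1 (x ⊗ₜ c))

theorem exists_counit_eq_one [Nontrivial Q] : ∃ x, H.counit x = 1 := by
  have h : ∃ x, H.counit x ≠ 0 := by
    by_contra! h
    have h0 : H.counit = 0 := LinearMap.ext h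
    obtain ⟨x, hx⟩ := exists_ne (0 : Q)
    exact hx (H.nondegenerate.1 x fun y => by rw [← H.isCounit_counit.1 x y, h0]; simp)
  obtain ⟨x, hx⟩ := h
  exact ⟨(H.counit x)⁻¹ • x, by simp [hx]⟩

theorem lid_counit_comulLeft (x : Q) (w : Q ⊗[k] Q) :
    TensorProduct.lid k Q (H.counit.rTensor Q (H.comulLeft x w))
      = x * TensorProduct.lid k Q (H.counit.rTensor Q w) := by
  refine H.eq_of_T₁ (f := (TensorProduct.lid k Q).toLinearMap ∘ₗ H.counit.rTensor Q ∘ₗ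
    H.comulLeft x) (g := LinearMap.mulLeft k x ∘ₗ (TensorProduct.lid k Q).toLinearMap ∘ₗ
    H.counit.rTensor Q) (fun p q => ?_) w
  simp only [LinearMap.comp_apply, LinearEquiv.coe_coe, ← T₁_mul_tmul, H.isCounit_counit.1,
    LinearMap.mulLeft_apply, mul_assoc]

theorem counit_mul (x y : Q) : H.counit (x * y) = H.counit x * H.counit y := by
  rcases subsingleton_or_nontrivial Q with hQ | hQ
  · simp [Subsingleton.elim x 0]
  obtain ⟨c, hc⟩ := exists_ne (0 : Q)
  have h := H.eq_of_T₁ (f := (TensorProduct.lid k Q).toLinearMap ∘ₗ H.counit.rTensor Q ∘ₗ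
    (LinearMap.mulRight k y).rTensor Q) (g := H.counit y • ((TensorProduct.lid k Q).toLinearMap ∘ₗ
    H.counit.rTensor Q)) (fun p q => by
      simp only [LinearMap.comp_apply, LinearEquiv.coe_coe, ← comulLeft_tmul,
        lid_counit_comulLeft, LinearMap.smul_apply, H.isCounit_counit.1]
      simp [mul_smul_comm]) (x ⊗ₜ c)
  have h' : H.counit (x * y) • c = H.counit y • H.counit x • c := by simpa using h
  rw [smul_smul, mul_comm] at h'
  exact smul_left_injective k hc h'

/-! ### The antipode -/

/-- `L(T₁(x ⊗ y)) = ε(x) y`; it will turn out that `L(x ⊗ y) = S(x) y`. -/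
noncomputable def antipodeMul : Q ⊗[k] Q →ₗ[k] Q :=
  (TensorProduct.lid k Q).toLinearMap ∘ₗ H.counit.rTensor Q ∘ₗ H.T₁Inv

/-- `R(T₂(x ⊗ y)) = ε(y) x`; it will turn out that `R(x ⊗ y) = x S(y)`. -/
noncomputable def mulAntipode : Q ⊗[k] Q →ₗ[k] Q :=
  (TensorProduct.rid k Q).toLinearMap ∘ₗ H.counit.lTensor Q ∘ₗ H.T₂Inv

theorem antipodeMul_T₁ (x y : Q) : H.antipodeMul (H.T₁ (x ⊗ₜ y)) = H.counit x • y := by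
  simp [antipodeMul]

theorem mulAntipode_T₂ (x y : Q) : H.mulAntipode (H.T₂ (x ⊗ₜ y)) = H.counit y • x := by
  simp [mulAntipode]

theorem antipodeMul_comulLeft (z : Q) (w : Q ⊗[k] Q) :
    H.antipodeMul (H.comulLeft z w) = H.counit z • H.antipodeMul w := by
  refine H.eq_of_T₁ (f := H.antipodeMul ∘ₗ H.comulLeft z) (g := H.counit z • H.antipodeMul)
    (fun p q => ?_) w
  simp only [LinearMap.comp_apply, LinearMap.smul_apply, ← T₁_mul_tmul, antipodeMul_T₁,
    counit_mul, smul_smul]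

theorem antipodeMul_mulRight (y : Q) (w : Q ⊗[k] Q) :
    H.antipodeMul ((LinearMap.mulRight k y).lTensor Q w) = H.antipodeMul w * y := by
  refine H.eq_of_T₁ (f := H.antipodeMul ∘ₗ (LinearMap.mulRight k y).lTensor Q)
    (g := LinearMap.mulRight k y ∘ₗ H.antipodeMul) (fun p q => ?_) w
  simp only [LinearMap.comp_apply, ← T₁_tmul_mul, antipodeMul_T₁, LinearMap.mulRight_apply,
    smul_mul_assoc]

/-- `R(a ⊗ b) c = a L(b ⊗ c)`: both sides are `a S(b) c`. This is where coassociativity enters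
the construction of the antipode. -/
theorem mulAntipode_mul (a b c : Q) :
    H.mulAntipode (a ⊗ₜ b) * c = a * H.antipodeMul (b ⊗ₜ c) := by
  have h1 : ∀ (z : Q) (u : Q ⊗[k] Q),
      LinearMap.mul' k Q ((H.antipodeMul ∘ₗ H.T₁).lTensor Q (TensorProduct.assoc k Q Q Q (u ⊗ₜ z)))
        = TensorProduct.rid k Q (H.counit.lTensor Q u) * z := by
    intro z u
    induction u using TensorProduct.induction_on with
    | zero => simp
    | add u v hu hv => simp only [TensorProduct.add_tmul, map_add, hu, hv, add_mul]
    | tmul p q => simp [antipodeMul_T₁, smul_mul_assoc]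
  have h2 : ∀ (x : Q) (w : Q ⊗[k] Q),
      LinearMap.mul' k Q ((H.mulAntipode ∘ₗ H.T₂).rTensor Q
        ((TensorProduct.assoc k Q Q Q).symm (x ⊗ₜ w)))
        = x * TensorProduct.lid k Q (H.counit.rTensor Q w) := by
    intro x w
    induction w using TensorProduct.induction_on with
    | zero => simp
    | add u v hu hv => simp only [TensorProduct.tmul_add, map_add, hu, hv, mul_add]
    | tmul p q => simp [mulAntipode_T₂, mul_smul_comm, smul_mul_assoc]
  have h3 : (LinearMap.mul' k Q ∘ₗ H.mulAntipode.rTensor Q ∘ₗ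
      (TensorProduct.assoc k Q Q Q).symm.toLinearMap) ∘ₗ H.T₁.lTensor Q ∘ₗ
        (TensorProduct.assoc k Q Q Q).toLinearMap ∘ₗ H.T₂.rTensor Q
      = (LinearMap.mul' k Q ∘ₗ H.antipodeMul.lTensor Q) ∘ₗ H.T₁.lTensor Q ∘ₗ
        (TensorProduct.assoc k Q Q Q).toLinearMap ∘ₗ H.T₂.rTensor Q := by
    refine TensorProduct.ext_threefold fun x y z => ?_
    simp only [LinearMap.comp_apply, LinearEquiv.coe_coe, LinearMap.rTensor_tmul]
    rw [← LinearMap.lTensor_comp_apply, h1, H.isCounit_counit.2, ← H.coassoc,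
      LinearEquiv.symm_apply_apply, ← LinearMap.rTensor_comp_apply, h2, H.isCounit_counit.1,
      mul_assoc]
  have h4 := LinearMap.congr_fun h3 (H.T₂Inv.rTensor Q ((TensorProduct.assoc k Q Q Q).symm
    (H.T₁Inv.lTensor Q (a ⊗ₜ (b ⊗ₜ c)))))
  have e1 : ∀ t, H.T₂.rTensor Q (H.T₂Inv.rTensor Q t) = t := fun t => by
    rw [← LinearMap.rTensor_comp_apply, LinearMap.ext H.T₂_T₂Inv (f := H.T₂ ∘ₗ H.T₂Inv)
      (g := LinearMap.id), LinearMap.rTensor_id, LinearMap.id_apply]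
  simp only [LinearMap.comp_apply, LinearEquiv.coe_coe, e1, LinearEquiv.apply_symm_apply,
    LinearMap.lTensor_tmul, LinearMap.mul'_apply, T₁_T₁Inv, TensorProduct.assoc_symm_tmul,
    LinearMap.rTensor_tmul] at h4
  exact h4

/-- Any `S` with the first half of `IsAntipode` satisfies `S(x) y = L(x ⊗ y)`. -/
theorem mul'_rTensor_eq {S : Q →ₗ[k] Q} (h : ∀ x y : Q,
    LinearMap.mul' k Q (S.rTensor Q (H.T₁ (x ⊗ₜ y))) = H.counit x • y) (u : Q ⊗[k] Q) :
    LinearMap.mul' k Q (S.rTensor Q u) = H.antipodeMul u :=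
  H.eq_of_T₁ (f := LinearMap.mul' k Q ∘ₗ S.rTensor Q) (g := H.antipodeMul) (fun x y => by
    rw [LinearMap.comp_apply, h, antipodeMul_T₁]) u

theorem isAntipode_unique {S S' : Q →ₗ[k] Q} (h : H.IsAntipode S) (h' : H.IsAntipode S') :
    S = S' :=
  LinearMap.ext fun x => H.nondegenerate.eq_of_mul_right fun y => by
    have h1 := H.mul'_rTensor_eq h.1 (x ⊗ₜ y)
    rw [← H.mul'_rTensor_eq h'.1 (x ⊗ₜ y)] at h1
    simpa using h1

/-! ### Regularity and the bijectivity of the antipode -/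

/-- The comultiplication of `H'` is the flip of the comultiplication of `H`. -/
def IsCop (H H' : MultiplierHopfAlgebra k Q) : Prop := ∀ x, H'.comul x = (H.comul x).flip

section Regular

variable {H} {H' : MultiplierHopfAlgebra k Q}

theorem IsCop.symm (hc : H.IsCop H') : H'.IsCop H := fun x => by rw [hc x, Multiplier.flip_flip]

theorem IsCop.comulLeft (hc : H.IsCop H') (x : Q) (v : Q ⊗[k] Q) : H'.comulLeft x v
    = TensorProduct.comm k Q Q (H.comulLeft x (TensorProduct.comm k Q Q v)) := by
  simp only [MultiplierHopfAlgebra.comulLeft, hc x, left_flip]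

/-- The flipped value of `H'.T₁` at `x ⊗ y` is `Δ(x)(y ⊗ 1)`. -/
theorem IsCop.comm_T₁_mul (hc : H.IsCop H') (x y : Q) (v : Q ⊗[k] Q) :
    TensorProduct.comm k Q Q (H'.T₁ (x ⊗ₜ y)) * v
      = H.comulLeft x ((LinearMap.mulLeft k y).rTensor Q v) := by
  have h := congrArg (TensorProduct.comm k Q Q) (H'.T₁_mul x y (TensorProduct.comm k Q Q v))
  rw [comm_mul, hc.comulLeft, TensorProduct.comm_comm, TensorProduct.comm_comm] at h
  rw [h, ← LinearMap.comm_comp_lTensor_comp_comm_eq]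
  rfl

/-- `(Δ(z)(x ⊗ 1))(1 ⊗ y) = Δ(z)(x ⊗ y)` -/
theorem IsCop.mulRight_comm_T₁ (hc : H.IsCop H') (x y z : Q) :
    (LinearMap.mulRight k y).lTensor Q (TensorProduct.comm k Q Q (H'.T₁ (z ⊗ₜ x)))
      = H.comulLeft z (x ⊗ₜ y) :=
  H.nondegenerate_tensor.eq_of_mul_right fun v => by
    rw [lTensor_mulRight_mul, hc.comm_T₁_mul, ← comulLeft_mul_assoc, tmul_mul_eq]

/-- `(z ⊗ 1)(Δ(x)(y ⊗ 1)) = ((z ⊗ 1)Δ(x))(y ⊗ 1)` -/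
theorem IsCop.mulLeft_comm_T₁ (hc : H.IsCop H') (x y z : Q) :
    (LinearMap.mulLeft k z).rTensor Q (TensorProduct.comm k Q Q (H'.T₁ (x ⊗ₜ y)))
      = (LinearMap.mulRight k y).rTensor Q (H.T₂ (z ⊗ₜ x)) :=
  H.nondegenerate_tensor.eq_of_mul_right fun v => by
    rw [rTensor_mulLeft_mul, hc.comm_T₁_mul, rTensor_mulRight_mul, T₂_mul]

theorem IsCop.counit_eq (hc : H.IsCop H') : H.counit = H'.counit := by
  refine H'.eq_counit fun x y => H.nondegenerate.eq_of_mul_left fun z => ?_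
  have h1 : ∀ u : Q ⊗[k] Q, TensorProduct.lid k Q (H.counit.rTensor Q u)
      = TensorProduct.rid k Q (H.counit.lTensor Q (TensorProduct.comm k Q Q u)) := by
    intro u
    induction u using TensorProduct.induction_on with
    | zero => simp
    | add u v hu hv => simp only [map_add, hu, hv]
    | tmul p q => simp
  have h2 : ∀ u : Q ⊗[k] Q, z * TensorProduct.rid k Q (H.counit.lTensor Q u)
      = TensorProduct.rid k Q (H.counit.lTensor Q ((LinearMap.mulLeft k z).rTensor Q u)) := by
    intro u
    induction u using TensorProduct.induction_on with
    | zero => simp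
    | add u v hu hv => simp only [map_add, mul_add, hu, hv]
    | tmul p q => simp [mul_smul_comm]
  have h3 : ∀ u : Q ⊗[k] Q, TensorProduct.rid k Q (H.counit.lTensor Q u) * y
      = TensorProduct.rid k Q (H.counit.lTensor Q ((LinearMap.mulRight k y).rTensor Q u)) := by
    intro u
    induction u using TensorProduct.induction_on with
    | zero => simp
    | add u v hu hv => simp only [map_add, add_mul, hu, hv]
    | tmul p q => simp [smul_mul_assoc]
  rw [h1, h2, hc.mulLeft_comm_T₁, ← h3, H.isCounit_counit.2, mul_assoc]

/-- The antipode takes values in `Q` itself: `S(x) = L(Δ(z)(x ⊗ 1))` for any `z` with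
`ε(z) = 1`. -/
theorem IsCop.exists_isAntipode (hc : H.IsCop H') : ∃ S : Q →ₗ[k] Q, H.IsAntipode S := by
  rcases subsingleton_or_nontrivial Q with hQ | hQ
  · exact ⟨0, fun x y => Subsingleton.elim _ _, fun x y => Subsingleton.elim _ _⟩
  obtain ⟨z, hz⟩ := H.exists_counit_eq_one
  let S : Q →ₗ[k] Q := H.antipodeMul ∘ₗ (TensorProduct.comm k Q Q).toLinearMap ∘ₗ H'.T₁ ∘ₗ
    TensorProduct.mk k Q Q z
  have hS : ∀ x y, S x * y = H.antipodeMul (x ⊗ₜ y) := by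
    intro x y
    simp only [S, LinearMap.comp_apply, LinearEquiv.coe_coe, TensorProduct.mk_apply]
    rw [← antipodeMul_mulRight, hc.mulRight_comm_T₁, antipodeMul_comulLeft, hz, one_smul]
  have hS' : ∀ x y, x * S y = H.mulAntipode (x ⊗ₜ y) := fun x y =>
    H.nondegenerate.eq_of_mul_right fun c => by rw [mulAntipode_mul, mul_assoc, hS]
  have h1 : LinearMap.mul' k Q ∘ₗ S.rTensor Q = H.antipodeMul :=
    TensorProduct.ext' fun x y => by simp [hS]
  have h2 : LinearMap.mul' k Q ∘ₗ S.lTensor Q = H.mulAntipode :=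
    TensorProduct.ext' fun x y => by simp [hS']
  refine ⟨S, fun x y => ?_, fun x y => ?_⟩
  · rw [← antipodeMul_T₁, ← h1]; rfl
  · rw [← mulAntipode_T₂, ← h2]; rfl

theorem IsCop.isAntipode (hc : H.IsCop H') : H.IsAntipode H.antipode :=
  Classical.epsilon_spec hc.exists_isAntipode

theorem IsCop.antipode_apply_mul (hc : H.IsCop H') (x y : Q) :
    H.antipode x * y = H.antipodeMul (x ⊗ₜ y) := by
  rw [← H.mul'_rTensor_eq hc.isAntipode.1]; simp

theorem IsCop.antipode_mul (hc : H.IsCop H') (x y : Q) :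
    H.antipode (x * y) = H.antipode y * H.antipode x := by
  refine H.nondegenerate.eq_of_mul_right fun c => ?_
  have h := H.eq_of_T₁ (f := H.antipodeMul ∘ₗ (LinearMap.mulRight k y).rTensor Q)
    (g := LinearMap.mulLeft k (H.antipode y) ∘ₗ H.antipodeMul) (fun p q => by
      simp only [LinearMap.comp_apply, ← comulLeft_tmul, antipodeMul_comulLeft, antipodeMul_T₁,
        LinearMap.mulLeft_apply, hc.antipode_apply_mul, map_smul]) (x ⊗ₜ c)
  simp only [LinearMap.comp_apply, LinearMap.rTensor_tmul, LinearMap.mulLeft_apply,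
    LinearMap.mulRight_apply, ← hc.antipode_apply_mul] at h
  rw [h, mul_assoc]

/-- The antipodes of `(Q, Δ)` and of `(Q, τΔ)` are inverse to each other. -/
theorem IsCop.antipode_antipode (hc : H.IsCop H') (x : Q) : H'.antipode (H.antipode x) = x := by
  rcases subsingleton_or_nontrivial Q with hQ | hQ
  · exact Subsingleton.elim _ _
  have h1 : ∀ a b, H'.antipodeMul (TensorProduct.comm k Q Q (H.T₁ (a ⊗ₜ b)))
      = H.counit a • H'.antipode b := by
    intro a b
    refine H.nondegenerate.eq_of_mul_right fun c => ?_
    have h2 : (LinearMap.mulRight k c).lTensor Q (TensorProduct.comm k Q Q (H.T₁ (a ⊗ₜ b)))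
        = H'.comulLeft a (b ⊗ₜ c) := hc.symm.mulRight_comm_T₁ b c a
    rw [← antipodeMul_mulRight, h2, antipodeMul_comulLeft, ← hc.symm.antipode_apply_mul,
      hc.counit_eq, smul_mul_assoc]
  have h2 : ∀ p q, H'.antipode q * H'.antipode (H.antipode p) = H'.antipode q * p := by
    intro p q
    have h := H.eq_of_T₁ (f := H'.antipode ∘ₗ H.antipodeMul)
      (g := H'.antipodeMul ∘ₗ (TensorProduct.comm k Q Q).toLinearMap) (fun a b => by
        simp only [LinearMap.comp_apply, LinearEquiv.coe_coe, antipodeMul_T₁, h1, map_smul])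
      (p ⊗ₜ q)
    simpa [← hc.antipode_apply_mul, ← hc.symm.antipode_apply_mul, hc.symm.antipode_mul] using h
  obtain ⟨z, hz⟩ := H'.exists_counit_eq_one
  refine H.nondegenerate.eq_of_mul_left fun c => ?_
  have h3 : ∀ w : Q ⊗[k] Q, LinearMap.mul' k Q (H'.antipode.lTensor Q w)
      * H'.antipode (H.antipode x) = LinearMap.mul' k Q (H'.antipode.lTensor Q w) * x := by
    intro w
    induction w using TensorProduct.induction_on with
    | zero => simp
    | add u v hu hv => simp only [map_add, add_mul, hu, hv]
    | tmul p q => simp [mul_assoc, h2]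
  simpa [hc.symm.isAntipode.2, hz] using h3 (H'.T₂ (c ⊗ₜ z))

theorem IsCop.antipode_bijective (hc : H.IsCop H') : Function.Bijective H.antipode :=
  Function.bijective_iff_has_inverse.2
    ⟨H'.antipode, hc.antipode_antipode, hc.symm.antipode_antipode⟩

theorem IsCop.antipodeInv_mul (hc : H.IsCop H') :
    H.antipodeInv * H.antipode = 1 ∧ H.antipode * H.antipodeInv = 1 := by
  have h : IsUnit (M := Module.End k Q) H.antipode :=
    (Module.End.isUnit_iff _).2 hc.antipode_bijective
  exact ⟨Ring.inverse_mul_cancel _ h, Ring.mul_inverse_cancel _ h⟩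

/-! ### Local units -/

/-- `Δ(q)(1 ⊗ a) ∈ Q ⊗ Qa`, hence `ε(q) a = S(q₁) q₂ a ∈ Qa`. -/
theorem IsCop.exists_mul_eq_self (hc : H.IsCop H') (a : Q) : ∃ e, e * a = a := by
  rcases subsingleton_or_nontrivial Q with hQ | hQ
  · exact ⟨0, Subsingleton.elim _ _⟩
  let N : Submodule k Q := LinearMap.range (LinearMap.mulRight k a)
  obtain ⟨z, hz⟩ := H.exists_counit_eq_one
  have h1 : N.mkQ.lTensor Q (H.T₁ (z ⊗ₜ a)) = 0 := by
    refine tensor_eq_zero_of_rTensor (fun x : Q => LinearMap.mulLeft k x)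
      (fun v hv => H.nondegenerate.2 v hv) _ fun x => ?_
    have h0 : N.mkQ ∘ₗ LinearMap.mulRight k a = 0 := LinearMap.range_mkQ_comp _
    rw [rTensor_lTensor_comm, mulLeft_T₁, ← LinearMap.lTensor_comp_apply, h0]
    simp
  obtain ⟨w, hw⟩ := (lTensor_exact Q (LinearMap.exact_subtype_mkQ N) N.mkQ_surjective _).1 h1
  have h2 : ∀ w : Q ⊗[k] N, LinearMap.mul' k Q (H.antipode.rTensor Q (N.subtype.lTensor Q w))
      ∈ N := by
    intro w
    induction w using TensorProduct.induction_on with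
    | zero => simp
    | add u v hu hv => simp only [map_add]; exact N.add_mem hu hv
    | tmul p n =>
      obtain ⟨n, ⟨b, rfl⟩⟩ := n
      exact ⟨H.antipode p * b, by simp [mul_assoc]⟩
  have h3 := h2 w
  rw [hw, hc.isAntipode.1, hz, one_smul] at h3
  exact h3

theorem IsCop.exists_self_mul_eq (hc : H.IsCop H') (a : Q) : ∃ e, a * e = a := by
  rcases subsingleton_or_nontrivial Q with hQ | hQ
  · exact ⟨0, Subsingleton.elim _ _⟩
  let N : Submodule k Q := LinearMap.range (LinearMap.mulLeft k a)
  obtain ⟨z, hz⟩ := H.exists_counit_eq_one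
  have h1 : N.mkQ.rTensor Q (H.T₂ (a ⊗ₜ z)) = 0 := by
    refine tensor_eq_zero_of_lTensor_family (fun x : Q => LinearMap.mulRight k x)
      (fun v hv => H.nondegenerate.1 v hv) _ fun x => ?_
    have h0 : N.mkQ ∘ₗ LinearMap.mulLeft k a = 0 := LinearMap.range_mkQ_comp _
    rw [← rTensor_lTensor_comm, ← mulLeft_T₁, ← LinearMap.rTensor_comp_apply, h0]
    simp
  obtain ⟨w, hw⟩ := (rTensor_exact Q (LinearMap.exact_subtype_mkQ N) N.mkQ_surjective _).1 h1
  have h2 : ∀ w : N ⊗[k] Q, LinearMap.mul' k Q (H.antipode.lTensor Q (N.subtype.rTensor Q w))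
      ∈ N := by
    intro w
    induction w using TensorProduct.induction_on with
    | zero => simp
    | add u v hu hv => simp only [map_add]; exact N.add_mem hu hv
    | tmul n p =>
      obtain ⟨n, ⟨b, rfl⟩⟩ := n
      exact ⟨b * H.antipode p, by simp [mul_assoc]⟩
  have h3 := h2 w
  rw [hw, hc.isAntipode.2, hz, one_smul] at h3
  exact h3

end Regular
end MultiplierHopfAlgebra

/-- Units for single elements of an associative algebra combine to units for finite sets. -/
theorem exists_unit_finset {k Q : Type*} [Field k] [AddCommGroup Q] [Module k Q]
    (μ : Q →ₗ[k] Q →ₗ[k] Q) (hμ : ∀ x y z, μ (μ x y) z = μ x (μ y z))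
    (h : ∀ a, ∃ e, μ e a = a) (s : Finset Q) : ∃ e, ∀ x ∈ s, μ e x = x := by
  classical
  induction s using Finset.induction_on with
  | empty => exact ⟨0, by simp⟩
  | insert a s _ ih =>
    obtain ⟨e, he⟩ := ih
    obtain ⟨f, hf⟩ := h (a - μ e a)
    refine ⟨e + f - μ f e, fun x hx => ?_⟩
    rcases Finset.mem_insert.1 hx with rfl | hx
    · rw [map_sub] at hf
      rw [map_sub, map_add, LinearMap.sub_apply, LinearMap.add_apply, hμ, add_sub_assoc, hf,
        add_sub_cancel]
    · simp [hμ, he x hx]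

/-! ### Coactions on modules in terms of linear maps -/

/-- The structure maps of a regular multiplier Hopf algebra and the identities between them that
coactions and module algebras need. The product is a bilinear map, not an instance, so that
reversing it together with the comultiplication (`HopfMaps.opcop`) stays on the same type; this
symmetry exchanges left and right. -/
structure HopfMaps (k Q : Type*) [Field k] [AddCommGroup Q] [Module k Q] where
  mul : Q →ₗ[k] Q →ₗ[k] Q
  /-- `T₁(x ⊗ y) = Δ(x)(1 ⊗ y)` -/
  T₁ : Q ⊗[k] Q →ₗ[k] Q ⊗[k] Q
  /-- `T₂(x ⊗ y) = (x ⊗ 1)Δ(y)` -/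
  T₂ : Q ⊗[k] Q →ₗ[k] Q ⊗[k] Q
  counit : Q →ₗ[k] k
  antipode : Q →ₗ[k] Q
  antipodeInv : Q →ₗ[k] Q
  mul_assoc : ∀ x y z, mul (mul x y) z = mul x (mul y z)
  eq_zero_of_mul_left : ∀ a, (∀ b, mul b a = 0) → a = 0
  eq_zero_of_mul_right : ∀ a, (∀ b, mul a b = 0) → a = 0
  T₁_surjective : Function.Surjective T₁
  T₂_surjective : Function.Surjective T₂
  mul_T₁ : ∀ x y z, (mul x).rTensor Q (T₁ (y ⊗ₜ z)) = (mul.flip z).lTensor Q (T₂ (x ⊗ₜ y))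
  exists_counit_eq_one : Nontrivial Q → ∃ x, counit x = 1
  counit_mul : ∀ x y, counit (mul x y) = counit x * counit y
  counit_T₁ : ∀ x y, TensorProduct.lid k Q (counit.rTensor Q (T₁ (x ⊗ₜ y))) = mul x y
  counit_T₂ : ∀ x y, TensorProduct.rid k Q (counit.lTensor Q (T₂ (x ⊗ₜ y))) = mul x y
  antipode_T₁ : ∀ x y, TensorProduct.lift mul (antipode.rTensor Q (T₁ (x ⊗ₜ y))) = counit x • y
  antipode_T₂ : ∀ x y, TensorProduct.lift mul (antipode.lTensor Q (T₂ (x ⊗ₜ y))) = counit y • x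
  antipode_mul : ∀ x y, antipode (mul x y) = mul (antipode y) (antipode x)
  antipodeInv_antipode : ∀ x, antipodeInv (antipode x) = x
  antipode_antipodeInv : ∀ x, antipode (antipodeInv x) = x
  exists_left_unit : ∀ s : Finset Q, ∃ e, ∀ x ∈ s, mul e x = x
  exists_right_unit : ∀ s : Finset Q, ∃ e, ∀ x ∈ s, mul x e = x

namespace HopfMaps

variable {k Q : Type*} [Field k] [AddCommGroup Q] [Module k Q] (D : HopfMaps k Q)

theorem antipodeInv_mul (x y : Q) :
    D.antipodeInv (D.mul x y) = D.mul (D.antipodeInv y) (D.antipodeInv x) := by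
  rw [← D.antipodeInv_antipode (D.mul (D.antipodeInv y) (D.antipodeInv x)), D.antipode_mul,
    D.antipode_antipodeInv, D.antipode_antipodeInv]

/-- `y₂ S⁻¹(x y₁) = ε(y) S⁻¹(x)` -/
theorem antipodeInv_T₂ (x y : Q) :
    TensorProduct.lift (D.mul.flip ∘ₗ D.antipodeInv) (D.T₂ (x ⊗ₜ y))
      = D.counit y • D.antipodeInv x := by
  rw [← D.antipodeInv_antipode (TensorProduct.lift _ _), ← map_smul, ← D.antipode_T₂]
  congr 1
  induction D.T₂ (x ⊗ₜ y) using TensorProduct.induction_on with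
  | zero => simp
  | add u v hu hv => simp only [map_add, hu, hv]
  | tmul p q => simp [D.antipode_mul, D.antipode_antipodeInv]

/-- Two linear maps on `Q ⊗ Q` agree as soon as they agree on the values of `T₁`. -/
theorem eq_of_T₁ {V : Type*} [AddCommGroup V] [Module k V] {f g : Q ⊗[k] Q →ₗ[k] V}
    (h : ∀ x y, f (D.T₁ (x ⊗ₜ y)) = g (D.T₁ (x ⊗ₜ y))) (u : Q ⊗[k] Q) : f u = g u := by
  have h1 : f ∘ₗ D.T₁ = g ∘ₗ D.T₁ := TensorProduct.ext' h
  obtain ⟨v, rfl⟩ := D.T₁_surjective u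
  exact LinearMap.congr_fun h1 v

/-- The opposite algebra with the opposite comultiplication. -/
def opcop : HopfMaps k Q where
  mul := D.mul.flip
  T₁ := (TensorProduct.comm k Q Q).toLinearMap ∘ₗ D.T₂ ∘ₗ (TensorProduct.comm k Q Q).toLinearMap
  T₂ := (TensorProduct.comm k Q Q).toLinearMap ∘ₗ D.T₁ ∘ₗ (TensorProduct.comm k Q Q).toLinearMap
  counit := D.counit
  antipode := D.antipode
  antipodeInv := D.antipodeInv
  mul_assoc x y z := (D.mul_assoc z y x).symm
  eq_zero_of_mul_left := D.eq_zero_of_mul_right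
  eq_zero_of_mul_right := D.eq_zero_of_mul_left
  T₁_surjective := by
    simpa using D.T₂_surjective
  T₂_surjective := by
    simpa using D.T₁_surjective
  mul_T₁ x y z := by
    simp only [LinearMap.comp_apply, LinearEquiv.coe_coe, TensorProduct.comm_tmul,
      LinearMap.flip_flip]
    rw [LinearMap.rTensor_comm, LinearMap.lTensor_comm, D.mul_T₁]
  exists_counit_eq_one := D.exists_counit_eq_one
  counit_mul x y := by
    rw [LinearMap.flip_apply, D.counit_mul, mul_comm]
  counit_T₁ x y := by
    rw [LinearMap.flip_apply, ← D.counit_T₂]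
    simp only [LinearMap.comp_apply, LinearEquiv.coe_coe, TensorProduct.comm_tmul]
    induction D.T₂ (y ⊗ₜ x) using TensorProduct.induction_on with
    | zero => simp
    | add u v hu hv => simp only [map_add, hu, hv]
    | tmul p q => simp
  counit_T₂ x y := by
    rw [LinearMap.flip_apply, ← D.counit_T₁]
    simp only [LinearMap.comp_apply, LinearEquiv.coe_coe, TensorProduct.comm_tmul]
    induction D.T₁ (y ⊗ₜ x) using TensorProduct.induction_on with
    | zero => simp
    | add u v hu hv => simp only [map_add, hu, hv]
    | tmul p q => simp
  antipode_T₁ x y := by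
    rw [← D.antipode_T₂]
    simp only [LinearMap.comp_apply, LinearEquiv.coe_coe, TensorProduct.comm_tmul]
    induction D.T₂ (y ⊗ₜ x) using TensorProduct.induction_on with
    | zero => simp
    | add u v hu hv => simp only [map_add, hu, hv]
    | tmul p q => simp
  antipode_T₂ x y := by
    rw [← D.antipode_T₁]
    simp only [LinearMap.comp_apply, LinearEquiv.coe_coe, TensorProduct.comm_tmul]
    induction D.T₁ (y ⊗ₜ x) using TensorProduct.induction_on with
    | zero => simp
    | add u v hu hv => simp only [map_add, hu, hv]
    | tmul p q => simp
  antipode_mul x y := D.antipode_mul y x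
  antipodeInv_antipode := D.antipodeInv_antipode
  antipode_antipodeInv := D.antipode_antipodeInv
  exists_left_unit := D.exists_right_unit
  exists_right_unit := D.exists_left_unit

end HopfMaps

/-- A left comodule algebra over the Hopf structure `D`, in terms of the maps
`Γ₁ b x = Γ(b)(x ⊗ 1)` and `Γ₂ x b = (x ⊗ 1)Γ(b)`, with the product of `B` a bilinear map. -/
structure CoactionMaps {k Q : Type*} [Field k] [AddCommGroup Q] [Module k Q] (D : HopfMaps k Q)
    (B : Type*) [AddCommGroup B] [Module k B] where
  mul : B →ₗ[k] B →ₗ[k] B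
  Γ₁ : B →ₗ[k] Q →ₗ[k] Q ⊗[k] B
  Γ₂ : Q →ₗ[k] B →ₗ[k] Q ⊗[k] B
  Γ₁_mul : ∀ b x y, Γ₁ b (D.mul x y) = (D.mul.flip y).rTensor B (Γ₁ b x)
  Γ₂_mul : ∀ x y b, Γ₂ (D.mul x y) b = (D.mul x).rTensor B (Γ₂ y b)
  mul_Γ₁ : ∀ x b y, (D.mul x).rTensor B (Γ₁ b y) = (D.mul.flip y).rTensor B (Γ₂ x b)
  eq_zero_of_Γ₁ : ∀ b, (∀ x, Γ₁ b x = 0) → b = 0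
  /-- `Γ(b b')(x ⊗ 1) = Γ(b) Γ(b')(x ⊗ 1)` -/
  mul_tmul_Γ₁ : ∀ b b' x, Γ₁ (mul b b') x
    = TensorProduct.lift ((LinearMap.lTensorHom Q ∘ₗ mul.flip).flip ∘ₗ Γ₁ b) (Γ₁ b' x)
  coassoc : ∀ (x y : Q) (b : B),
    (TensorProduct.lift Γ₁.flip).lTensor Q (TensorProduct.assoc k Q Q B
        ((D.T₂ ∘ₗ (TensorProduct.mk k Q Q).flip y).rTensor B (Γ₂ x b)))
      = TensorProduct.assoc k Q Q B
          ((D.T₂ ∘ₗ TensorProduct.mk k Q Q x).rTensor B (Γ₁ b y))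

namespace CoactionMaps

variable {k Q B : Type*} [Field k] [AddCommGroup Q] [Module k Q] [AddCommGroup B] [Module k B]
  {D : HopfMaps k Q} (C : CoactionMaps D B)

/-- `s ⊗ t ↦ (id ⊗ Γ)(Γ(b)(s ⊗ 1)) (1 ⊗ t ⊗ 1)` -/
noncomputable def iterate (b : B) : Q ⊗[k] Q →ₗ[k] Q ⊗[k] (Q ⊗[k] B) :=
  (TensorProduct.lift C.Γ₁).lTensor Q ∘ₗ (TensorProduct.assoc k Q B Q).toLinearMap ∘ₗ
    (C.Γ₁ b).rTensor Q

/-- Coassociativity, multiplied on the right by `Δ(y)(1 ⊗ r)` instead of being covered from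
both sides. -/
theorem iterate_T₁ (b : B) (y r : Q) : C.iterate b (D.T₁ (y ⊗ₜ r))
    = TensorProduct.assoc k Q Q B
        ((D.T₁ ∘ₗ (TensorProduct.mk k Q Q).flip r).rTensor B (C.Γ₁ b y)) := by
  rw [← sub_eq_zero]
  refine tensor_eq_zero_of_rTensor (fun x : Q => D.mul x) D.eq_zero_of_mul_left _ fun x => ?_
  rw [map_sub, sub_eq_zero]
  -- `K v (s ⊗ t) = (id ⊗ Γ)(v (s ⊗ 1)) (1 ⊗ t ⊗ 1)`
  let K : Q ⊗[k] B → Q ⊗[k] Q →ₗ[k] Q ⊗[k] (Q ⊗[k] B) := fun v =>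
    (TensorProduct.lift C.Γ₁).lTensor Q ∘ₗ (TensorProduct.assoc k Q B Q).toLinearMap ∘ₗ
      ((LinearMap.rTensorHom B ∘ₗ D.mul.flip).flip v).rTensor Q
  have hK : ∀ u v w, K (u + v) w = K u w + K v w := fun u v w => by
    simp [K, LinearMap.rTensor_add]
  have hK0 : ∀ w, K 0 w = 0 := fun w => by simp [K]
  have hA : ∀ w, (D.mul x).rTensor (Q ⊗[k] B) (C.iterate b w) = K (C.Γ₂ x b) w := by
    intro w
    have h1 : ∀ (v : Q ⊗[k] B) (t : Q), (D.mul x).rTensor (Q ⊗[k] B)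
        ((TensorProduct.lift C.Γ₁).lTensor Q (TensorProduct.assoc k Q B Q (v ⊗ₜ t)))
        = (TensorProduct.lift C.Γ₁).lTensor Q
          (TensorProduct.assoc k Q B Q ((D.mul x).rTensor B v ⊗ₜ t)) := by
      intro v t
      induction v using TensorProduct.induction_on with
      | zero => simp
      | add u v hu hv => simp only [TensorProduct.add_tmul, map_add, hu, hv]
      | tmul p q => simp
    induction w using TensorProduct.induction_on with
    | zero => simp
    | add u v hu hv => simp only [map_add, hu, hv]
    | tmul s t =>
      simp only [iterate, K, LinearMap.comp_apply, LinearEquiv.coe_coe, LinearMap.rTensor_tmul, h1,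
        C.mul_Γ₁]
      rfl
  have hB : ∀ v, K v (D.T₁ (y ⊗ₜ r)) = ((D.mul.flip r).rTensor B).lTensor Q
      ((TensorProduct.lift C.Γ₁.flip).lTensor Q (TensorProduct.assoc k Q Q B
        ((D.T₂ ∘ₗ (TensorProduct.mk k Q Q).flip y).rTensor B v))) := by
    intro v
    induction v using TensorProduct.induction_on with
    | zero => simp [hK0]
    | add u v hu hv => simp only [hK, map_add, hu, hv]
    | tmul q c =>
      have h1 : ∀ w, K (q ⊗ₜ c) w = (C.Γ₁ c).lTensor Q ((D.mul q).rTensor Q w) := by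
        intro w
        induction w using TensorProduct.induction_on with
        | zero => simp
        | add u v hu hv => simp only [map_add, hu, hv]
        | tmul s t => simp [K]
      rw [h1, D.mul_T₁]
      simp only [LinearMap.rTensor_tmul, LinearMap.comp_apply, LinearMap.flip_apply,
        TensorProduct.mk_apply]
      induction D.T₂ (q ⊗ₜ y) using TensorProduct.induction_on with
      | zero => simp
      | add u v hu hv => simp only [TensorProduct.add_tmul, map_add, hu, hv]
      | tmul s t => simp [C.Γ₁_mul]
  have hC : ∀ v, ((D.mul.flip r).rTensor B).lTensor Q (TensorProduct.assoc k Q Q B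
      ((D.T₂ ∘ₗ TensorProduct.mk k Q Q x).rTensor B v))
      = (D.mul x).rTensor (Q ⊗[k] B) (TensorProduct.assoc k Q Q B
        ((D.T₁ ∘ₗ (TensorProduct.mk k Q Q).flip r).rTensor B v)) := by
    intro v
    induction v using TensorProduct.induction_on with
    | zero => simp
    | add u v hu hv => simp only [map_add, hu, hv]
    | tmul q c =>
      have h1 : ∀ u : Q ⊗[k] Q, ((D.mul.flip r).rTensor B).lTensor Q
          (TensorProduct.assoc k Q Q B (u ⊗ₜ c))
          = TensorProduct.assoc k Q Q B ((D.mul.flip r).lTensor Q u ⊗ₜ c) := by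
        intro u
        induction u using TensorProduct.induction_on with
        | zero => simp
        | add u v hu hv => simp only [TensorProduct.add_tmul, map_add, hu, hv]
        | tmul s t => simp
      have h2 : ∀ u : Q ⊗[k] Q, (D.mul x).rTensor (Q ⊗[k] B)
          (TensorProduct.assoc k Q Q B (u ⊗ₜ c))
          = TensorProduct.assoc k Q Q B ((D.mul x).rTensor Q u ⊗ₜ c) := by
        intro u
        induction u using TensorProduct.induction_on with
        | zero => simp
        | add u v hu hv => simp only [TensorProduct.add_tmul, map_add, hu, hv]
        | tmul s t => simp
      simp only [LinearMap.rTensor_tmul, LinearMap.comp_apply, LinearMap.flip_apply,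
        TensorProduct.mk_apply, h1, h2, D.mul_T₁]
  rw [hA, hB, C.coassoc, hC]

/-- `(ε ⊗ id)(Γ(b)(y ⊗ 1)) = ε(y) b`. With `E(b) = (ε ⊗ id)Γ(b)`, coassociativity gives
`Γ(E(b)) = Γ(b)`, and `Γ` is injective. -/
theorem counit_Γ₁ (b : B) (y : Q) :
    TensorProduct.lid k B (D.counit.rTensor B (C.Γ₁ b y)) = D.counit y • b := by
  rcases subsingleton_or_nontrivial Q with hQ | hQ
  · rw [C.eq_zero_of_Γ₁ b fun x => by rw [Subsingleton.elim x 0, map_zero]]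
    simp
  obtain ⟨x₀, hx₀⟩ := D.exists_counit_eq_one hQ
  let E : B →ₗ[k] B := (TensorProduct.lid k B).toLinearMap ∘ₗ D.counit.rTensor B ∘ₗ C.Γ₂ x₀
  have hE : ∀ c t, TensorProduct.lid k B (D.counit.rTensor B (C.Γ₁ c t)) = D.counit t • E c := by
    intro c t
    have h1 : ∀ u : Q ⊗[k] B, TensorProduct.lid k B (D.counit.rTensor B
        ((D.mul x₀).rTensor B u)) = TensorProduct.lid k B (D.counit.rTensor B u) := by
      intro u
      induction u using TensorProduct.induction_on with
      | zero => simp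
      | add u v hu hv => simp only [map_add, hu, hv]
      | tmul s t => simp [D.counit_mul, hx₀]
    have h2 : ∀ u : Q ⊗[k] B, TensorProduct.lid k B (D.counit.rTensor B
        ((D.mul.flip t).rTensor B u))
        = D.counit t • TensorProduct.lid k B (D.counit.rTensor B u) := by
      intro u
      induction u using TensorProduct.induction_on with
      | zero => simp
      | add u v hu hv => simp only [map_add, hu, hv, smul_add]
      | tmul p q => simp [D.counit_mul, smul_smul, mul_comm]
    rw [← h1, C.mul_Γ₁, h2]; rfl
  have h3 : ∀ w, TensorProduct.lid k _ (D.counit.rTensor _ (C.iterate b w))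
      = C.Γ₁ (E b) (TensorProduct.lid k _ (D.counit.rTensor _ w)) := by
    intro w
    induction w using TensorProduct.induction_on with
    | zero => simp
    | add u v hu hv => simp only [map_add, hu, hv]
    | tmul s t =>
      have h4 : ∀ v : Q ⊗[k] B, TensorProduct.lid k _ (D.counit.rTensor _
          ((TensorProduct.lift C.Γ₁).lTensor Q (TensorProduct.assoc k Q B Q (v ⊗ₜ t))))
          = C.Γ₁ (TensorProduct.lid k B (D.counit.rTensor B v)) t := by
        intro v
        induction v using TensorProduct.induction_on with
        | zero => simp
        | add u v hu hv => simp only [TensorProduct.add_tmul, map_add, hu, hv, LinearMap.add_apply]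
        | tmul p q => simp
      simp only [iterate, LinearMap.comp_apply, LinearEquiv.coe_coe, LinearMap.rTensor_tmul, h4,
        hE]
      simp
  have h5 : ∀ y r, C.Γ₁ (E b) (D.mul y r) = C.Γ₁ b (D.mul y r) := by
    intro y r
    have h6 : ∀ v : Q ⊗[k] B, TensorProduct.lid k _ (D.counit.rTensor _
        (TensorProduct.assoc k Q Q B ((D.T₁ ∘ₗ (TensorProduct.mk k Q Q).flip r).rTensor B v)))
        = (D.mul.flip r).rTensor B v := by
      intro v
      induction v using TensorProduct.induction_on with
      | zero => simp
      | add u v hu hv => simp only [map_add, hu, hv]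
      | tmul q c =>
        have h7 : ∀ u : Q ⊗[k] Q, TensorProduct.lid k _ (D.counit.rTensor _
            (TensorProduct.assoc k Q Q B (u ⊗ₜ c)))
            = TensorProduct.lid k Q (D.counit.rTensor Q u) ⊗ₜ c := by
          intro u
          induction u using TensorProduct.induction_on with
          | zero => simp
          | add u v hu hv => simp only [TensorProduct.add_tmul, map_add, hu, hv]
          | tmul s t => simp [TensorProduct.smul_tmul']
        simp only [LinearMap.rTensor_tmul, LinearMap.comp_apply, LinearMap.flip_apply,
          TensorProduct.mk_apply, h7, D.counit_T₁]
    rw [← D.counit_T₁, ← h3, C.iterate_T₁, h6, D.counit_T₁, C.Γ₁_mul]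
  have h8 : E b = b := by
    rw [← sub_eq_zero]
    refine C.eq_zero_of_Γ₁ _ fun x => ?_
    obtain ⟨e, he⟩ := D.exists_left_unit {x}
    rw [map_sub, LinearMap.sub_apply, ← he x (Finset.mem_singleton_self x), h5, sub_self]
  rw [hE, h8]

/-- `S(b₍₋₂₎ s) b₍₋₁₎ ⊗ b₀ = S(s) ⊗ b` -/
theorem Γ₂_antipode_Γ₁ (b : B) (s : Q) :
    TensorProduct.lift C.Γ₂ (D.antipode.rTensor B (C.Γ₁ b s)) = D.antipode s ⊗ₜ b := by
  have h1 : ∀ w, TensorProduct.lift (LinearMap.rTensorHom B ∘ₗ D.mul ∘ₗ D.antipode)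
      (C.iterate b w) = TensorProduct.lift D.mul (D.antipode.rTensor Q w) ⊗ₜ b := by
    refine D.eq_of_T₁ (f := TensorProduct.lift (LinearMap.rTensorHom B ∘ₗ D.mul ∘ₗ D.antipode) ∘ₗ
      C.iterate b) (g := (TensorProduct.mk k Q B).flip b ∘ₗ TensorProduct.lift D.mul ∘ₗ
      D.antipode.rTensor Q) fun y r => ?_
    simp only [LinearMap.comp_apply, LinearMap.flip_apply, TensorProduct.mk_apply, D.antipode_T₁,
      C.iterate_T₁]
    have h2 : ∀ v : Q ⊗[k] B, TensorProduct.lift (LinearMap.rTensorHom B ∘ₗ D.mul ∘ₗ D.antipode)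
        (TensorProduct.assoc k Q Q B ((D.T₁ ∘ₗ (TensorProduct.mk k Q Q).flip r).rTensor B v))
        = r ⊗ₜ TensorProduct.lid k B (D.counit.rTensor B v) := by
      intro v
      induction v using TensorProduct.induction_on with
      | zero => simp
      | add u v hu hv => simp only [map_add, hu, hv, TensorProduct.tmul_add]
      | tmul q c =>
        have h7 : ∀ u : Q ⊗[k] Q, TensorProduct.lift (LinearMap.rTensorHom B ∘ₗ D.mul ∘ₗ D.antipode)
            (TensorProduct.assoc k Q Q B (u ⊗ₜ c))
            = TensorProduct.lift D.mul (D.antipode.rTensor Q u) ⊗ₜ c := by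
          intro u
          induction u using TensorProduct.induction_on with
          | zero => simp
          | add u v hu hv => simp only [TensorProduct.add_tmul, map_add, hu, hv]
          | tmul s t => simp
        simp only [LinearMap.rTensor_tmul, LinearMap.comp_apply, LinearMap.flip_apply,
          TensorProduct.mk_apply, h7, D.antipode_T₁]
        simp [TensorProduct.smul_tmul']
    rw [h2, C.counit_Γ₁, TensorProduct.tmul_smul, TensorProduct.smul_tmul']
  rw [← sub_eq_zero]
  refine tensor_eq_zero_of_rTensor (fun t : Q => D.mul.flip t) D.eq_zero_of_mul_right _ fun t => ?_
  rw [map_sub, sub_eq_zero]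
  have h3 : ∀ v : Q ⊗[k] B, TensorProduct.lift (LinearMap.rTensorHom B ∘ₗ D.mul ∘ₗ D.antipode)
      ((TensorProduct.lift C.Γ₁).lTensor Q (TensorProduct.assoc k Q B Q (v ⊗ₜ t)))
      = (D.mul.flip t).rTensor B (TensorProduct.lift C.Γ₂ (D.antipode.rTensor B v)) := by
    intro v
    induction v using TensorProduct.induction_on with
    | zero => simp
    | add u v hu hv => simp only [TensorProduct.add_tmul, map_add, hu, hv]
    | tmul p q => simp [C.mul_Γ₁]
  rw [← h3]
  exact (h1 (s ⊗ₜ t)).trans (by simp)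

/-- `b₍₋₁₎ S⁻¹(x b₍₋₂₎) ⊗ b₀ = S⁻¹(x) ⊗ b` -/
theorem Γ₁_antipodeInv_Γ₂ (x : Q) (b : B) :
    TensorProduct.lift C.Γ₁.flip (D.antipodeInv.rTensor B (C.Γ₂ x b))
      = D.antipodeInv x ⊗ₜ b := by
  rcases subsingleton_or_nontrivial Q with hQ | hQ
  · rw [C.eq_zero_of_Γ₁ b fun x => by rw [Subsingleton.elim x 0, map_zero]]
    simp
  obtain ⟨y, hy⟩ := D.exists_counit_eq_one hQ
  -- `N (u ⊗ (w ⊗ c)) = w S⁻¹(u) ⊗ c`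
  let N := TensorProduct.lift (LinearMap.rTensorHom B ∘ₗ D.mul.flip ∘ₗ D.antipodeInv)
  have h := congrArg N (C.coassoc x y b)
  have h1 : ∀ v, N ((TensorProduct.lift C.Γ₁.flip).lTensor Q (TensorProduct.assoc k Q Q B
      ((D.T₂ ∘ₗ (TensorProduct.mk k Q Q).flip y).rTensor B v)))
      = TensorProduct.lift C.Γ₁.flip (D.antipodeInv.rTensor B v) := by
    intro v
    induction v using TensorProduct.induction_on with
    | zero => simp
    | add u v hu hv => simp only [map_add, hu, hv]
    | tmul q c =>
      have h2 : ∀ u : Q ⊗[k] Q, N ((TensorProduct.lift C.Γ₁.flip).lTensor Q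
          (TensorProduct.assoc k Q Q B (u ⊗ₜ c)))
          = C.Γ₁ c (TensorProduct.lift (D.mul.flip ∘ₗ D.antipodeInv) u) := by
        intro u
        induction u using TensorProduct.induction_on with
        | zero => simp
        | add u v hu hv => simp only [TensorProduct.add_tmul, map_add, hu, hv]
        | tmul s t => simp [N, C.Γ₁_mul]
      simp only [LinearMap.rTensor_tmul, LinearMap.comp_apply, LinearMap.flip_apply,
        TensorProduct.mk_apply, h2, D.antipodeInv_T₂, hy, one_smul, TensorProduct.lift.tmul]
  have h3 : ∀ v, N (TensorProduct.assoc k Q Q B ((D.T₂ ∘ₗ TensorProduct.mk k Q Q x).rTensor B v))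
      = D.antipodeInv x ⊗ₜ TensorProduct.lid k B (D.counit.rTensor B v) := by
    intro v
    induction v using TensorProduct.induction_on with
    | zero => simp
    | add u v hu hv => simp only [map_add, hu, hv, TensorProduct.tmul_add]
    | tmul q c =>
      have h2 : ∀ u : Q ⊗[k] Q, N (TensorProduct.assoc k Q Q B (u ⊗ₜ c))
          = TensorProduct.lift (D.mul.flip ∘ₗ D.antipodeInv) u ⊗ₜ c := by
        intro u
        induction u using TensorProduct.induction_on with
        | zero => simp
        | add u v hu hv => simp only [TensorProduct.add_tmul, map_add, hu, hv]
        | tmul s t => simp [N]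
      simp only [LinearMap.rTensor_tmul, LinearMap.comp_apply, TensorProduct.mk_apply, h2,
        D.antipodeInv_T₂]
      simp [TensorProduct.smul_tmul']
  rwa [h1, h3, C.counit_Γ₁, hy, one_smul] at h

end CoactionMaps

/-! ### Twisting a module algebra by a coaction -/

/-- A unital left module algebra over the Hopf structure `D`. The compatibility with the product
says that `p ↦ ∑ (p₁ ▷ a)(p₂ r ▷ a')` is a module map `Q → A`. -/
structure ModuleMaps {k Q : Type*} [Field k] [AddCommGroup Q] [Module k Q] (D : HopfMaps k Q)
    (A : Type*) [AddCommGroup A] [Module k A] where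
  mul : A →ₗ[k] A →ₗ[k] A
  act : Q →ₗ[k] A →ₗ[k] A
  mul_act : ∀ x y a, act (D.mul x y) a = act x (act y a)
  act_unital : Submodule.span k {c : A | ∃ (x : Q) (a : A), act x a = c} = ⊤
  act_mul : ∀ x p r a a', act x (TensorProduct.lift mul
      (TensorProduct.map (act.flip a) (act.flip a') (D.T₁ (p ⊗ₜ r))))
    = TensorProduct.lift mul
      (TensorProduct.map (act.flip a) (act.flip a') (D.T₁ (D.mul x p ⊗ₜ r)))

/-- Linear maps out of a unital module over an algebra with local units (an action `act` of `Q`,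
and a product `μ`) are balanced maps out of `Q ⊗ A`. -/
theorem exists_linearMap_of_balanced {k Q A W : Type*} [Field k] [AddCommGroup Q] [Module k Q]
    [AddCommGroup A] [Module k A] [AddCommGroup W] [Module k W]
    (μ : Q →ₗ[k] Q →ₗ[k] Q) (hμ : ∀ s : Finset Q, ∃ e, ∀ x ∈ s, μ e x = x)
    (act : Q →ₗ[k] A →ₗ[k] A)
    (hact : Submodule.span k {c : A | ∃ (x : Q) (a : A), act x a = c} = ⊤)
    (G : Q →ₗ[k] A →ₗ[k] W) (hG : ∀ x y a, G (μ x y) a = G x (act y a)) :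
    ∃ F : A →ₗ[k] W, ∀ x a, F (act x a) = G x a := by
  classical
  have h1 : ∀ u : Q ⊗[k] A, ∃ s : Finset Q, ∀ e, (∀ x ∈ s, μ e x = x) →
      TensorProduct.lift G u = G e (TensorProduct.lift act u) := by
    intro u
    induction u using TensorProduct.induction_on with
    | zero => exact ⟨∅, by simp⟩
    | add u v hu hv =>
      obtain ⟨s, hs⟩ := hu
      obtain ⟨t, ht⟩ := hv
      refine ⟨s ∪ t, fun e he => ?_⟩
      rw [map_add, map_add, map_add, hs e fun x hx => he x (Finset.mem_union_left _ hx),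
        ht e fun x hx => he x (Finset.mem_union_right _ hx)]
    | tmul x a =>
      refine ⟨{x}, fun e he => ?_⟩
      rw [TensorProduct.lift.tmul, TensorProduct.lift.tmul, ← hG,
        he x (Finset.mem_singleton_self x)]
  have h2 : LinearMap.range (TensorProduct.lift act) = ⊤ := by
    rw [eq_top_iff, ← hact, Submodule.span_le]
    rintro _ ⟨x, a, rfl⟩
    exact ⟨x ⊗ₜ a, by simp⟩
  obtain ⟨g, hg⟩ := (TensorProduct.lift act).exists_rightInverse_of_surjective h2
  refine ⟨TensorProduct.lift G ∘ₗ g, fun x a => ?_⟩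
  have h3 : TensorProduct.lift act (g (act x a) - x ⊗ₜ a) = 0 := by
    have := LinearMap.congr_fun hg (act x a)
    rw [LinearMap.comp_apply, LinearMap.id_apply] at this
    rw [map_sub, this, TensorProduct.lift.tmul, sub_self]
  obtain ⟨s, hs⟩ := h1 (g (act x a) - x ⊗ₜ a)
  obtain ⟨e, he⟩ := hμ s
  have h4 := hs e he
  rw [h3, map_zero, map_sub, sub_eq_zero] at h4
  simpa using h4

section Expand

variable {k X Y : Type*} [Field k] [AddCommGroup X] [Module k X] [AddCommGroup Y] [Module k Y]

/-- `p ⊗ q ↦ x_T p ⊗ q_T` where `T(x ⊗ q) = x_T ⊗ q_T`. -/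
noncomputable def expandFst (μ : X →ₗ[k] X →ₗ[k] X) (T : X ⊗[k] Y →ₗ[k] X ⊗[k] Y) (x : X) :
    X ⊗[k] Y →ₗ[k] X ⊗[k] Y :=
  TensorProduct.lift ((LinearMap.rTensorHom Y ∘ₗ μ.flip).flip ∘ₗ T ∘ₗ TensorProduct.mk k X Y x).flip

@[simp] theorem expandFst_tmul (μ : X →ₗ[k] X →ₗ[k] X) (T : X ⊗[k] Y →ₗ[k] X ⊗[k] Y) (x p : X)
    (q : Y) : expandFst μ T x (p ⊗ₜ q) = (μ.flip p).rTensor Y (T (x ⊗ₜ q)) := by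
  simp [expandFst]

/-- `p ⊗ q ↦ p_T ⊗ q y_T` where `T(p ⊗ y) = p_T ⊗ y_T`. -/
noncomputable def expandSnd (μ : Y →ₗ[k] Y →ₗ[k] Y) (T : X ⊗[k] Y →ₗ[k] X ⊗[k] Y) (y : Y) :
    X ⊗[k] Y →ₗ[k] X ⊗[k] Y :=
  TensorProduct.lift ((LinearMap.lTensorHom X ∘ₗ μ).flip ∘ₗ T ∘ₗ (TensorProduct.mk k X Y).flip y)

@[simp] theorem expandSnd_tmul (μ : Y →ₗ[k] Y →ₗ[k] Y) (T : X ⊗[k] Y →ₗ[k] X ⊗[k] Y) (y q : Y)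
    (p : X) : expandSnd μ T y (p ⊗ₜ q) = (μ q).lTensor X (T (p ⊗ₜ y)) := by
  simp [expandSnd]

end Expand

section Twist

variable {k Q A B : Type*} [Field k] [AddCommGroup Q] [Module k Q] [AddCommGroup B] [Module k B]
  [AddCommGroup A] [Module k A] {D : HopfMaps k Q} (C : CoactionMaps D B) (M : ModuleMaps D A)

theorem ModuleMaps.ext_act {W : Type*} [AddCommGroup W] [Module k W] {F G : A →ₗ[k] W}
    (h : ∀ x a, F (M.act x a) = G (M.act x a)) : F = G := by
  refine LinearMap.ext_on M.act_unital ?_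
  rintro _ ⟨x, a, rfl⟩
  exact h x a

theorem ModuleMaps.ext_tensor {W : Type*} [AddCommGroup W] [Module k W]
    {F G : B ⊗[k] A →ₗ[k] W} (h : ∀ b x a, F (b ⊗ₜ M.act x a) = G (b ⊗ₜ M.act x a)) : F = G :=
  TensorProduct.ext (LinearMap.ext fun b => M.ext_act fun x a => h b x a)

/-- `F` is the map `b ⊗ a ↦ ∑ b₀ ⊗ (b₍₋₁₎ ▷ a)`. -/
def IsTwist (F : B ⊗[k] A →ₗ[k] B ⊗[k] A) : Prop :=
  ∀ (b : B) (x : Q) (a : A), F (b ⊗ₜ M.act x a)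
    = (M.act.flip a).lTensor B (TensorProduct.comm k Q B (C.Γ₁ b x))

/-- `F` is the map `b ⊗ a ↦ ∑ b₀ ⊗ (S⁻¹(b₍₋₁₎) ▷ a)`. -/
def IsTwistInv (F : B ⊗[k] A →ₗ[k] B ⊗[k] A) : Prop :=
  ∀ (b : B) (x : Q) (a : A), F (b ⊗ₜ M.act (D.antipodeInv x) a)
    = (M.act.flip a ∘ₗ D.antipodeInv).lTensor B (TensorProduct.comm k Q B (C.Γ₂ x b))

theorem existsUnique_isTwist : ∃! F, IsTwist C M F := by
  let G : Q →ₗ[k] A →ₗ[k] B →ₗ[k] B ⊗[k] A := LinearMap.mk₂ k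
    (fun x a => (M.act.flip a).lTensor B ∘ₗ (TensorProduct.comm k Q B).toLinearMap ∘ₗ C.Γ₁.flip x)
    (fun x y a => by ext; simp) (fun c x a => by ext; simp)
    (fun x a a' => by ext; simp [LinearMap.lTensor_add])
    (fun c x a => by ext; simp [LinearMap.lTensor_smul])
  obtain ⟨F, hF⟩ := exists_linearMap_of_balanced D.mul D.exists_left_unit M.act M.act_unital G
    (fun x y a => by
      ext b
      simp only [G, LinearMap.mk₂_apply, LinearMap.comp_apply, LinearMap.flip_apply, C.Γ₁_mul,
        LinearEquiv.coe_coe]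
      rw [← LinearMap.lTensor_comm, ← LinearMap.lTensor_comp_apply]
      congr 2
      ext p
      simp [M.mul_act])
  refine ⟨TensorProduct.lift F.flip, fun b x a => ?_, fun F' hF' => M.ext_tensor fun b x a => ?_⟩
  · simp [hF, G]
  · rw [hF']
    simp [hF, G]

theorem existsUnique_isTwistInv : ∃! F, IsTwistInv C M F := by
  let G : Q →ₗ[k] A →ₗ[k] B →ₗ[k] B ⊗[k] A := LinearMap.mk₂ k
    (fun x a => (M.act.flip a ∘ₗ D.antipodeInv).lTensor B ∘ₗ
      (TensorProduct.comm k Q B).toLinearMap ∘ₗ C.Γ₂ x)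
    (fun x y a => by ext; simp) (fun c x a => by ext; simp)
    (fun x a a' => by ext; simp [LinearMap.lTensor_add, LinearMap.add_comp])
    (fun c x a => by ext; simp [LinearMap.lTensor_smul, LinearMap.smul_comp])
  have hs : ∀ x a, M.act x a = M.act (D.antipodeInv (D.antipode x)) a := fun x a => by
    rw [D.antipodeInv_antipode]
  obtain ⟨F, hF⟩ := exists_linearMap_of_balanced D.mul.flip D.exists_right_unit
    (M.act ∘ₗ D.antipodeInv) (by
      rw [← M.act_unital]
      congr 1
      ext c
      constructor
      · rintro ⟨x, a, rfl⟩; exact ⟨_, a, rfl⟩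
      · rintro ⟨x, a, rfl⟩; exact ⟨_, a, (hs x a).symm⟩) G
    (fun x y a => by
      ext b
      simp only [G, LinearMap.mk₂_apply, LinearMap.comp_apply, LinearMap.flip_apply, C.Γ₂_mul,
        LinearEquiv.coe_coe]
      rw [← LinearMap.lTensor_comm, ← LinearMap.lTensor_comp_apply]
      congr 2
      ext p
      simp [D.antipodeInv_mul, M.mul_act])
  refine ⟨TensorProduct.lift F.flip, fun b x a => ?_, fun F' hF' => M.ext_tensor fun b x a => ?_⟩
  · have h := LinearMap.congr_fun (hF x a) b
    simpa [G] using h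
  · have h := LinearMap.congr_fun (hF (D.antipode x) a) b
    rw [hs, hF']
    simpa [G] using h.symm

variable {C M} {F F' : B ⊗[k] A →ₗ[k] B ⊗[k] A}

theorem IsTwistInv.comp_isTwist (hF' : IsTwistInv C M F') (hF : IsTwist C M F) (u : B ⊗[k] A) :
    F' (F u) = u := by
  have h : F' ∘ₗ F = LinearMap.id := M.ext_tensor fun b x a => by
    have h1 : ∀ v : Q ⊗[k] B, F' ((M.act.flip a).lTensor B (TensorProduct.comm k Q B v))
        = (M.act.flip a ∘ₗ D.antipodeInv).lTensor B (TensorProduct.comm k Q B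
          (TensorProduct.lift C.Γ₂ (D.antipode.rTensor B v))) := by
      intro v
      induction v using TensorProduct.induction_on with
      | zero => simp
      | add u v hu hv => simp only [map_add, hu, hv]
      | tmul q c =>
        have h2 := hF' c (D.antipode q) a
        rw [D.antipodeInv_antipode] at h2
        simpa using h2
    rw [LinearMap.comp_apply, hF, h1, C.Γ₂_antipode_Γ₁]
    simp [D.antipodeInv_antipode]
  exact LinearMap.congr_fun h u

theorem IsTwist.comp_isTwistInv (hF : IsTwist C M F) (hF' : IsTwistInv C M F') (u : B ⊗[k] A) :
    F (F' u) = u := by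
  have h : F ∘ₗ F' = LinearMap.id := M.ext_tensor fun b x a => by
    have h1 : ∀ v : Q ⊗[k] B, F ((M.act.flip a ∘ₗ D.antipodeInv).lTensor B
        (TensorProduct.comm k Q B v))
        = (M.act.flip a).lTensor B (TensorProduct.comm k Q B
          (TensorProduct.lift C.Γ₁.flip (D.antipodeInv.rTensor B v))) := by
      intro v
      induction v using TensorProduct.induction_on with
      | zero => simp
      | add u v hu hv => simp only [map_add, hu, hv]
      | tmul q c => simp [← hF c]
    rw [← D.antipodeInv_antipode x, LinearMap.comp_apply, hF', h1, C.Γ₁_antipodeInv_Γ₂]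
    simp
  exact LinearMap.congr_fun h u

/-- The twist is natural with respect to module maps `Q → A`. -/
theorem IsTwist.apply_moduleMap (hF : IsTwist C M F) (f : Q →ₗ[k] A)
    (hf : ∀ x p, f (D.mul x p) = M.act x (f p)) (b : B) (p : Q) :
    F (b ⊗ₜ f p) = f.lTensor B (TensorProduct.comm k Q B (C.Γ₁ b p)) := by
  obtain ⟨e, he⟩ := D.exists_left_unit {p}
  have hep := he p (Finset.mem_singleton_self p)
  have h1 : M.act.flip (f p) = f ∘ₗ D.mul.flip p := by ext q; simp [hf]
  rw [← hep, hf, hF, C.Γ₁_mul, h1, LinearMap.lTensor_comp_apply, LinearMap.lTensor_comm]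

/-- `∑ (b b')₀ ⊗ ((b b')₍₋₁₎ ▷ a) = ∑ b₀ b'₀ ⊗ (b₍₋₁₎ b'₍₋₁₎ ▷ a)` -/
theorem IsTwist.mul_tmul (hF : IsTwist C M F) (b b' : B) (a : A) :
    F (C.mul b b' ⊗ₜ a) = expandFst C.mul F b (F (b' ⊗ₜ a)) := by
  have h : F ∘ₗ TensorProduct.mk k B A (C.mul b b')
      = expandFst C.mul F b ∘ₗ F ∘ₗ TensorProduct.mk k B A b' := M.ext_act fun x a => by
    simp only [LinearMap.comp_apply, TensorProduct.mk_apply]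
    rw [hF, hF, C.mul_tmul_Γ₁]
    induction C.Γ₁ b' x using TensorProduct.induction_on with
    | zero => simp
    | add u v hu hv => simp only [map_add, hu, hv]
    | tmul q c =>
      simp only [TensorProduct.lift.tmul, LinearMap.comp_apply, LinearMap.flip_apply,
        LinearMap.coe_lTensorHom, TensorProduct.comm_tmul, LinearMap.lTensor_tmul, expandFst_tmul]
      rw [hF, rTensor_lTensor_comm, LinearMap.rTensor_comm]
  exact LinearMap.congr_fun h a

/-- `∑ b₀ ⊗ (b₍₋₁₎ ▷ a a') = ∑ b₀ ⊗ (b₍₋₂₎ ▷ a)(b₍₋₁₎ ▷ a')` -/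
theorem IsTwist.tmul_mul (hF : IsTwist C M F) (b : B) (a a' : A) :
    F (b ⊗ₜ M.mul a a') = expandSnd M.mul F a' (F (b ⊗ₜ a)) := by
  have key : ∀ (y z : Q) (a a' : A), F (b ⊗ₜ M.mul (M.act y a) (M.act z a'))
      = expandSnd M.mul F (M.act z a') (F (b ⊗ₜ M.act y a)) := by
    intro y z a a'
    let m : Q ⊗[k] Q →ₗ[k] A :=
      TensorProduct.lift M.mul ∘ₗ TensorProduct.map (M.act.flip a) (M.act.flip a')
    -- `Θ (q ⊗ (q' ⊗ c)) = c ⊗ (q ▷ a)(q' ▷ a')`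
    let Θ : Q ⊗[k] (Q ⊗[k] B) →ₗ[k] B ⊗[k] A := (TensorProduct.comm k A B).toLinearMap ∘ₗ
      m.rTensor B ∘ₗ (TensorProduct.assoc k Q Q B).symm.toLinearMap
    have h1 : ∀ s t, Θ (C.iterate b (s ⊗ₜ t))
        = expandSnd M.mul F (M.act t a') (F (b ⊗ₜ M.act s a)) := by
      intro s t
      rw [hF]
      simp only [CoactionMaps.iterate, LinearMap.comp_apply, LinearEquiv.coe_coe,
        LinearMap.rTensor_tmul]
      induction C.Γ₁ b s using TensorProduct.induction_on with
      | zero => simp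
      | add u v hu hv => simp only [TensorProduct.add_tmul, map_add, hu, hv]
      | tmul q c =>
        simp only [TensorProduct.assoc_tmul, LinearMap.lTensor_tmul, TensorProduct.lift.tmul,
          TensorProduct.comm_tmul, expandSnd_tmul, LinearMap.flip_apply]
        rw [hF]
        induction C.Γ₁ c t using TensorProduct.induction_on with
        | zero => simp
        | add u v hu hv => simp only [TensorProduct.tmul_add, map_add, hu, hv]
        | tmul q' c' => simp [Θ, m]
    have h2 : ∀ w, (F ∘ₗ TensorProduct.mk k B A b ∘ₗ m) w = (Θ ∘ₗ C.iterate b) w := by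
      refine D.eq_of_T₁ fun p r => ?_
      let f : Q →ₗ[k] A := m ∘ₗ D.T₁ ∘ₗ (TensorProduct.mk k Q Q).flip r
      have h3 := hF.apply_moduleMap f (fun x p => (M.act_mul x p r a a').symm) b p
      simp only [LinearMap.comp_apply, C.iterate_T₁, TensorProduct.mk_apply]
      refine h3.trans ?_
      simp only [Θ, f, LinearMap.comp_apply, LinearEquiv.coe_coe, LinearEquiv.symm_apply_apply]
      rw [← LinearMap.rTensor_comp_apply, ← LinearMap.lTensor_comm]
    rw [← h1 y z]
    simpa [m] using h2 (y ⊗ₜ z)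
  have h : ∀ (z : Q) (a' a : A), F (b ⊗ₜ M.mul a (M.act z a'))
      = expandSnd M.mul F (M.act z a') (F (b ⊗ₜ a)) := by
    intro z a' a
    have h1 : F ∘ₗ TensorProduct.mk k B A b ∘ₗ M.mul.flip (M.act z a')
        = expandSnd M.mul F (M.act z a') ∘ₗ F ∘ₗ TensorProduct.mk k B A b :=
      M.ext_act fun y a => key y z a a'
    exact LinearMap.congr_fun h1 a
  have hadd : ∀ u : B ⊗[k] A, ∃ g : A →ₗ[k] B ⊗[k] A, ∀ a', g a' = expandSnd M.mul F a' u := by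
    intro u
    induction u using TensorProduct.induction_on with
    | zero => exact ⟨0, by simp⟩
    | add u v hu hv =>
      obtain ⟨g, hg⟩ := hu
      obtain ⟨g', hg'⟩ := hv
      exact ⟨g + g', by simp [hg, hg']⟩
    | tmul c d => exact ⟨(M.mul d).lTensor B ∘ₗ F ∘ₗ TensorProduct.mk k B A c, by simp⟩
  obtain ⟨g, hg⟩ := hadd (F (b ⊗ₜ a))
  have h1 : F ∘ₗ TensorProduct.mk k B A b ∘ₗ M.mul a = g := M.ext_act fun z a' => by
    rw [hg]
    exact h z a' a
  rw [← hg, ← h1]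
  rfl

end Twist

/-! ### Twisted tensor products with a bijective twist -/

section TwistedTensor

variable {k X Y : Type*} [Field k]
  [NonUnitalRing X] [Module k X] [IsScalarTower k X X] [SMulCommClass k X X]
  [NonUnitalRing Y] [Module k Y] [IsScalarTower k Y Y] [SMulCommClass k Y Y]

/-- If `T` is multiplicative in both variables and commutes with `R` in both shared variables,
then `T` is a homomorphism from the twisted tensor product for `T⁻¹ R` and the identity to the one
for `R` and `T`. Only `T (T' u) = u` is needed of the inverse `T'`. -/
theorem map_twistedMul (R : Y ⊗[k] X →ₗ[k] X ⊗[k] Y) (T T' : X ⊗[k] Y →ₗ[k] X ⊗[k] Y)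
    (hT : ∀ u, T (T' u) = u)
    (hfst : ∀ x x' y, T ((x * x') ⊗ₜ y) = expandFst (LinearMap.mul k X) T x (T (x' ⊗ₜ y)))
    (hsnd : ∀ x y y', T (x ⊗ₜ (y * y')) = expandSnd (LinearMap.mul k Y) T y' (T (x ⊗ₜ y)))
    (hX : ∀ y x y', TensorProduct.rightComm k X Y Y
        ((T ∘ₗ (TensorProduct.mk k X Y).flip y').rTensor Y (R (y ⊗ₜ x)))
      = (R ∘ₗ TensorProduct.mk k Y X y).rTensor Y (T (x ⊗ₜ y')))
    (hY : ∀ x y x', TensorProduct.leftComm k X X Y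
        ((T ∘ₗ TensorProduct.mk k X Y x).lTensor X (R (y ⊗ₜ x')))
      = (R ∘ₗ (TensorProduct.mk k Y X).flip x').lTensor X (T (x ⊗ₜ y)))
    (u v : X ⊗[k] Y) :
    T (twistedMul (T' ∘ₗ R) LinearMap.id u v) = twistedMul R T (T u) (T v) := by
  let m : X ⊗[k] Y →ₗ[k] X ⊗[k] Y →ₗ[k] X ⊗[k] Y :=
    TensorProduct.map₂ (LinearMap.mul k X).flip (LinearMap.mul k Y)
  have hm : ∀ p q w, m (p ⊗ₜ q) w
      = (LinearMap.mul k Y q).lTensor X (((LinearMap.mul k X).flip p).rTensor Y w) := by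
    intro p q w
    induction w using TensorProduct.induction_on with
    | zero => simp
    | add u v hu hv => simp only [map_add, hu, hv]
    | tmul c d => simp [m]
  suffices h : ∀ x y x' y', T (twistedMul (T' ∘ₗ R) LinearMap.id (x ⊗ₜ y) (x' ⊗ₜ y'))
      = twistedMul R T (T (x ⊗ₜ y)) (T (x' ⊗ₜ y')) by
    induction u using TensorProduct.induction_on with
    | zero => simp
    | add u u' hu hu' => simp only [map_add, LinearMap.add_apply, hu, hu']
    | tmul x y =>
      induction v using TensorProduct.induction_on with
      | zero => simp
      | add v v' hv hv' => simp only [map_add, hv, hv']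
      | tmul x' y' => exact h x y x' y'
  intro x y x' y'
  have h1 : ∀ w, T (m w (x ⊗ₜ y'))
      = expandSnd (LinearMap.mul k Y) T y' (expandFst (LinearMap.mul k X) T x (T w)) := by
    intro w
    induction w using TensorProduct.induction_on with
    | zero => simp
    | add u v hu hv => simp only [map_add, LinearMap.add_apply, hu, hv]
    | tmul p q => rw [← hfst, ← hsnd]; simp [m]
  -- `Ξ p ((e ⊗ s) ⊗ f) = p_T e ⊗ s f_T`
  let Ξ : X → (X ⊗[k] Y) ⊗[k] Y →ₗ[k] X ⊗[k] Y := fun p =>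
    TensorProduct.lift (m.flip ∘ₗ T ∘ₗ TensorProduct.mk k X Y p).flip
  have hΞ : ∀ (c : k) p p' z, Ξ (c • p + p') z = c • Ξ p z + Ξ p' z := by
    intro c p p' z
    induction z using TensorProduct.induction_on with
    | zero => simp
    | add u v hu hv => simp only [map_add, hu, hv, smul_add]; abel
    | tmul d f => simp [Ξ]
  have hΞ0 : ∀ z, Ξ 0 z = 0 := fun z => by simpa using hΞ (-1) 0 0 z
  -- `Ψ (p ⊗ (r ⊗ s)) = p_T r_T' ⊗ s (y'_T')_T`
  let Ψ : X ⊗[k] (X ⊗[k] Y) →ₗ[k] X ⊗[k] Y := TensorProduct.lift (LinearMap.mk₂ k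
    (fun p w => Ξ p (TensorProduct.rightComm k X Y Y
      ((T ∘ₗ (TensorProduct.mk k X Y).flip y').rTensor Y w)))
    (fun p p' w => by simpa using hΞ 1 p p' _)
    (fun c p w => by simpa [hΞ0] using hΞ c p 0 _)
    (fun p w w' => by simp)
    (fun c p w => by simp))
  have h2 : ∀ v, expandSnd (LinearMap.mul k Y) T y' (expandFst (LinearMap.mul k X) T x v)
      = Ψ (TensorProduct.leftComm k X X Y ((T ∘ₗ TensorProduct.mk k X Y x).lTensor X v)) := by
    intro v
    induction v using TensorProduct.induction_on with
    | zero => simp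
    | add u v hu hv => simp only [map_add, hu, hv]
    | tmul r s =>
      simp only [expandFst_tmul, LinearMap.lTensor_tmul, LinearMap.comp_apply,
        TensorProduct.mk_apply]
      induction T (x ⊗ₜ s) using TensorProduct.induction_on with
      | zero => simp
      | add u v hu hv => simp only [map_add, TensorProduct.tmul_add, hu, hv]
      | tmul c d =>
        simp only [LinearMap.rTensor_tmul, LinearMap.flip_apply, LinearMap.mul_apply',
          expandSnd_tmul, hfst, Ψ, TensorProduct.leftComm_tmul, TensorProduct.lift.tmul,
          LinearMap.mk₂_apply, LinearMap.comp_apply, TensorProduct.mk_apply]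
        induction T (r ⊗ₜ y') using TensorProduct.induction_on with
        | zero => simp
        | add u v hu hv => simp only [map_add, TensorProduct.add_tmul, hu, hv]
        | tmul e f => simp [Ξ, hm]
  have h3 : ∀ w, Ψ ((R ∘ₗ (TensorProduct.mk k Y X).flip x').lTensor X w)
      = twistedMul R T w (T (x' ⊗ₜ y')) := by
    intro w
    induction w using TensorProduct.induction_on with
    | zero => simp
    | add u v hu hv => simp only [map_add, LinearMap.add_apply, hu, hv]
    | tmul p q =>
      simp only [LinearMap.lTensor_tmul, LinearMap.comp_apply, LinearMap.flip_apply,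
        TensorProduct.mk_apply, Ψ, TensorProduct.lift.tmul, LinearMap.mk₂_apply, hX]
      induction T (x' ⊗ₜ y') using TensorProduct.induction_on with
      | zero => simp
      | add u v hu hv => simp only [map_add, hu, hv]
      | tmul p' q' => simp [Ξ, twistedMul_tmul, m]
  rw [twistedMul_tmul, LinearMap.id_apply, LinearMap.comp_apply]
  exact (h1 _).trans (by rw [hT, h2, hY, h3])

end TwistedTensor

/-! ### The linear data of a regular multiplier Hopf algebra and its (co)module algebras -/

section Data

open Multiplier

variable {k Q A B : Type*} [Field k] [NonUnitalRing Q] [Module k Q]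
  [IsScalarTower k Q Q] [SMulCommClass k Q Q]
  [NonUnitalRing A] [Module k A] [IsScalarTower k A A] [SMulCommClass k A A]
  [NonUnitalRing B] [Module k B] [IsScalarTower k B B] [SMulCommClass k B B]
  {H H' : MultiplierHopfAlgebra k Q}

/-- The linear data of a regular multiplier Hopf algebra. -/
noncomputable def MultiplierHopfAlgebra.IsCop.hopfMaps (hc : H.IsCop H') : HopfMaps k Q where
  mul := LinearMap.mul k Q
  T₁ := H.T₁
  T₂ := H.T₂
  counit := H.counit
  antipode := H.antipode
  antipodeInv := H.antipodeInv
  mul_assoc := mul_assoc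
  eq_zero_of_mul_left := H.nondegenerate.2
  eq_zero_of_mul_right := H.nondegenerate.1
  T₁_surjective := H.T₁_bijective.2
  T₂_surjective := H.T₂_bijective.2
  mul_T₁ := H.mulLeft_T₁
  exists_counit_eq_one _ := H.exists_counit_eq_one
  counit_mul := H.counit_mul
  counit_T₁ := H.isCounit_counit.1
  counit_T₂ := H.isCounit_counit.2
  antipode_T₁ := hc.isAntipode.1
  antipode_T₂ := hc.isAntipode.2
  antipode_mul := hc.antipode_mul
  antipodeInv_antipode := LinearMap.congr_fun hc.antipodeInv_mul.1
  antipode_antipodeInv := LinearMap.congr_fun hc.antipodeInv_mul.2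
  exists_left_unit := exists_unit_finset (LinearMap.mul k Q) mul_assoc hc.exists_mul_eq_self
  exists_right_unit := exists_unit_finset (LinearMap.mul k Q).flip
    (fun x y z => (mul_assoc z y x).symm) hc.exists_self_mul_eq

section LeftComodule

variable (L : LeftComoduleAlgebra H B)

theorem LeftComoduleAlgebra.Γ₁_mul_eq (b : B) (x : Q) (v : Q ⊗[k] B) :
    L.Γ₁ b x * v = (L.Γ b).left ((LinearMap.mulLeft k x).rTensor B v) := by
  rw [← left_ofAlg (k := k), L.Γ₁_spec, left_mul, left_tmul_one]

theorem LeftComoduleAlgebra.Γ₂_mul_eq (x : Q) (b : B) (v : Q ⊗[k] B) :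
    L.Γ₂ x b * v = (LinearMap.mulLeft k x).rTensor B ((L.Γ b).left v) := by
  rw [← left_ofAlg (k := k), L.Γ₂_spec, left_mul, left_tmul_one]

/-- The linear data of a left comodule algebra. -/
noncomputable def LeftComoduleAlgebra.coactionMaps (hc : H.IsCop H') :
    CoactionMaps hc.hopfMaps B where
  mul := LinearMap.mul k B
  Γ₁ := L.Γ₁
  Γ₂ := L.Γ₂
  Γ₁_mul b x y := (H.nondegenerate.tensor L.nondegenerate).eq_of_mul_right fun v => by
    refine Eq.trans ?_ (rTensor_mulRight_mul y (L.Γ₁ b x) v).symm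
    change L.Γ₁ b (x * y) * v = _
    rw [L.Γ₁_mul_eq, L.Γ₁_mul_eq, ← LinearMap.rTensor_comp_apply, ← LinearMap.mulLeft_mul]
  Γ₂_mul x y b := (H.nondegenerate.tensor L.nondegenerate).eq_of_mul_right fun v => by
    refine Eq.trans ?_ (rTensor_mulLeft_mul x (L.Γ₂ y b) v).symm
    change L.Γ₂ (x * y) b * v = _
    rw [L.Γ₂_mul_eq, L.Γ₂_mul_eq, ← LinearMap.rTensor_comp_apply, ← LinearMap.mulLeft_mul]
  mul_Γ₁ x b y := (H.nondegenerate.tensor L.nondegenerate).eq_of_mul_right fun v => by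
    refine (rTensor_mulLeft_mul x (L.Γ₁ b y) v).trans
      (Eq.trans ?_ (rTensor_mulRight_mul y (L.Γ₂ x b) v).symm)
    rw [L.Γ₁_mul_eq, L.Γ₂_mul_eq]
  eq_zero_of_Γ₁ b hb := by
    refine L.Γ_injective ?_
    rw [map_zero]
    refine ext_left (H.nondegenerate.tensor L.nondegenerate) fun v => ?_
    change _ = 0
    induction v using TensorProduct.induction_on with
    | zero => rw [map_zero]
    | add u v hu hv => rw [map_add, hu, hv, add_zero]
    | tmul p c =>
      obtain ⟨e, he⟩ := hc.exists_mul_eq_self p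
      have h := L.Γ₁_mul_eq b e (p ⊗ₜ c)
      rw [hb, zero_mul, LinearMap.rTensor_tmul, LinearMap.mulLeft_apply, he] at h
      exact h.symm
  mul_tmul_Γ₁ b b' x := (H.nondegenerate.tensor L.nondegenerate).eq_of_mul_right fun v => by
    rw [LinearMap.mul_apply', L.Γ₁_mul_eq, map_mul, left_mul, ← L.Γ₁_mul_eq]
    induction L.Γ₁ b' x using TensorProduct.induction_on with
    | zero => simp
    | add u v hu hv => simp only [add_mul, map_add, hu, hv]
    | tmul q c =>
      rw [tmul_mul_eq, ← L.Γ₁_mul_eq, ← lTensor_mulRight_mul]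
      rfl
  coassoc := L.Γ_coassoc

end LeftComodule

section RightComodule

variable (L : RightComoduleAlgebra H B)

theorem RightComoduleAlgebra.Υ₁_mul_eq (b : B) (x : Q) (v : B ⊗[k] Q) :
    L.Υ₁ b x * v = (L.Υ b).left ((LinearMap.mulLeft k x).lTensor B v) := by
  rw [← left_ofAlg (k := k), L.Υ₁_spec, left_mul, left_one_tmul]

theorem RightComoduleAlgebra.Υ₂_mul_eq (x : Q) (b : B) (v : B ⊗[k] Q) :
    L.Υ₂ x b * v = (LinearMap.mulLeft k x).lTensor B ((L.Υ b).left v) := by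
  rw [← left_ofAlg (k := k), L.Υ₂_spec, left_mul, left_one_tmul]

theorem RightComoduleAlgebra.mul_Υ₂_eq (x : Q) (b : B) (v : B ⊗[k] Q) :
    v * L.Υ₂ x b = (L.Υ b).right ((LinearMap.mulRight k x).lTensor B v) := by
  rw [← right_ofAlg (k := k), L.Υ₂_spec, right_mul, right_one_tmul]

/-- The linear data of a right comodule algebra, as those of a left comodule algebra with
reversed product over the opposite and co-opposite Hopf structure. -/
noncomputable def RightComoduleAlgebra.coactionMaps (hc : H.IsCop H') :
    CoactionMaps hc.hopfMaps.opcop B where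
  mul := (LinearMap.mul k B).flip
  Γ₁ := (L.Υ₂.compr₂ (TensorProduct.comm k B Q).toLinearMap).flip
  Γ₂ := (L.Υ₁.compr₂ (TensorProduct.comm k B Q).toLinearMap).flip
  Γ₁_mul b x y := by
    have h : L.Υ₂ (y * x) b = (LinearMap.mulLeft k y).lTensor B (L.Υ₂ x b) :=
      (L.nondegenerate.tensor H.nondegenerate).eq_of_mul_right fun v => by
        rw [lTensor_mulLeft_mul, L.Υ₂_mul_eq, L.Υ₂_mul_eq, ← LinearMap.lTensor_comp_apply,
          ← LinearMap.mulLeft_mul]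
    change TensorProduct.comm k B Q (L.Υ₂ (y * x) b) = (LinearMap.mulLeft k y).rTensor B
      (TensorProduct.comm k B Q (L.Υ₂ x b))
    rw [h, LinearMap.rTensor_comm]
  Γ₂_mul x y b := by
    have h : L.Υ₁ b (y * x) = (LinearMap.mulRight k x).lTensor B (L.Υ₁ b y) :=
      (L.nondegenerate.tensor H.nondegenerate).eq_of_mul_right fun v => by
        rw [lTensor_mulRight_mul, L.Υ₁_mul_eq, L.Υ₁_mul_eq, ← LinearMap.lTensor_comp_apply,
          ← LinearMap.mulLeft_mul]
    change TensorProduct.comm k B Q (L.Υ₁ b (y * x)) = (LinearMap.mulRight k x).rTensor B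
      (TensorProduct.comm k B Q (L.Υ₁ b y))
    rw [h, LinearMap.rTensor_comm]
  mul_Γ₁ x b y := by
    have h : (LinearMap.mulRight k x).lTensor B (L.Υ₂ y b)
        = (LinearMap.mulLeft k y).lTensor B (L.Υ₁ b x) :=
      (L.nondegenerate.tensor H.nondegenerate).eq_of_mul_right fun v => by
        rw [lTensor_mulRight_mul, lTensor_mulLeft_mul, L.Υ₂_mul_eq, L.Υ₁_mul_eq]
    change (LinearMap.mulRight k x).rTensor B (TensorProduct.comm k B Q (L.Υ₂ y b))
      = (LinearMap.mulLeft k y).rTensor B (TensorProduct.comm k B Q (L.Υ₁ b x))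
    rw [LinearMap.rTensor_comm, LinearMap.rTensor_comm, h]
  eq_zero_of_Γ₁ b hb := by
    have hb' : ∀ x, L.Υ₂ x b = 0 := fun x =>
      (TensorProduct.comm k B Q).injective ((hb x).trans (map_zero _).symm)
    have hr : ∀ v, (L.Υ b).right v = 0 := by
      intro v
      induction v using TensorProduct.induction_on with
      | zero => rw [map_zero]
      | add u v hu hv => rw [map_add, hu, hv, add_zero]
      | tmul c p =>
        obtain ⟨e, he⟩ := hc.exists_self_mul_eq p
        have h := L.mul_Υ₂_eq e b (c ⊗ₜ p)
        rw [hb', mul_zero, LinearMap.lTensor_tmul, LinearMap.mulRight_apply, he] at h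
        exact h.symm
    refine L.Υ_injective ?_
    rw [map_zero]
    refine ext_left (L.nondegenerate.tensor H.nondegenerate) fun v => ?_
    change _ = 0
    exact (L.nondegenerate.tensor H.nondegenerate).2 _ fun w => by
      rw [← right_mul_eq, hr, zero_mul]
  mul_tmul_Γ₁ b b' x := by
    have h : L.Υ₂ x (b' * b) = TensorProduct.lift
        ((LinearMap.rTensorHom Q ∘ₗ LinearMap.mul k B).flip ∘ₗ L.Υ₂.flip b).flip (L.Υ₂ x b') :=
      (L.nondegenerate.tensor H.nondegenerate).eq_of_mul_right fun v => by
        rw [L.Υ₂_mul_eq, map_mul, left_mul, ← L.Υ₂_mul_eq]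
        induction L.Υ₂ x b' using TensorProduct.induction_on with
        | zero => simp
        | add u v hu hv => simp only [add_mul, map_add, hu, hv]
        | tmul c q =>
          rw [tmul_mul_eq, ← L.Υ₂_mul_eq, ← rTensor_mulLeft_mul]
          rfl
    change TensorProduct.comm k B Q (L.Υ₂ x (b' * b)) = TensorProduct.lift _
      (TensorProduct.comm k B Q (L.Υ₂ x b'))
    rw [h]
    induction L.Υ₂ x b' using TensorProduct.induction_on with
    | zero => simp
    | add u v hu hv => simp only [map_add, hu, hv]
    | tmul c q =>
      simp only [TensorProduct.lift.tmul, TensorProduct.comm_tmul]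
      exact (LinearMap.lTensor_comm _ _).symm
  coassoc x y b := by
    have h := congrArg (fun u => (TensorProduct.comm k B Q).toLinearMap.lTensor Q
      (TensorProduct.comm k (B ⊗[k] Q) Q u)) (L.Υ_coassoc x y b)
    refine Eq.trans ?_ (h.trans ?_)
    · change _ = (TensorProduct.comm k B Q).toLinearMap.lTensor Q
        (TensorProduct.comm k (B ⊗[k] Q) Q _)
      simp only [LinearMap.flip_apply, LinearMap.compr₂_apply, LinearEquiv.coe_coe]
      induction L.Υ₁ b x using TensorProduct.induction_on with
      | zero => simp
      | add u v hu hv => simp only [map_add, hu, hv]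
      | tmul c q =>
        simp only [HopfMaps.opcop, MultiplierHopfAlgebra.IsCop.hopfMaps, TensorProduct.comm_tmul,
          LinearMap.rTensor_tmul, LinearMap.lTensor_tmul, LinearMap.comp_apply,
          LinearMap.flip_apply, TensorProduct.mk_apply, LinearEquiv.coe_coe]
        induction H.T₁ (y ⊗ₜ q) using TensorProduct.induction_on with
        | zero => simp
        | add u v hu hv =>
          simp only [map_add, TensorProduct.add_tmul, TensorProduct.tmul_add, hu, hv]
        | tmul s t => simp
    · simp only [LinearMap.flip_apply, LinearMap.compr₂_apply, LinearEquiv.coe_coe]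
      induction L.Υ₂ y b using TensorProduct.induction_on with
      | zero => simp
      | add u v hu hv => simp only [map_add, hu, hv]
      | tmul c q =>
        simp only [HopfMaps.opcop, MultiplierHopfAlgebra.IsCop.hopfMaps, TensorProduct.comm_tmul,
          LinearMap.rTensor_tmul, LinearMap.lTensor_tmul, LinearMap.comp_apply,
          LinearMap.flip_apply, TensorProduct.mk_apply, LinearEquiv.coe_coe]
        induction H.T₁ (q ⊗ₜ x) using TensorProduct.induction_on with
        | zero => simp
        | add u v hu hv =>
          simp only [map_add, TensorProduct.add_tmul, TensorProduct.tmul_add, hu, hv]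
        | tmul s t => simp

end RightComodule

/-- The linear data of the left module algebra underlying a bimodule algebra. -/
noncomputable def BimoduleAlgebra.leftMaps (MA : BimoduleAlgebra H A) (hc : H.IsCop H') :
    ModuleMaps hc.hopfMaps A where
  mul := LinearMap.mul k A
  act := MA.lact
  mul_act := MA.mul_lact
  act_unital := MA.lact_unital
  act_mul x p r a a' := by
    have h : ∀ w, MA.lact x (LinearMap.mul' k A (TensorProduct.map (MA.lact.flip a)
        (MA.lact.flip a') w)) = LinearMap.mul' k A (TensorProduct.map (MA.lact.flip a)
        (MA.lact.flip a') (H.comulLeft x w)) := by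
      intro w
      induction w using TensorProduct.induction_on with
      | zero => simp
      | add u v hu hv => simp only [map_add, hu, hv]
      | tmul y z => simpa [MultiplierHopfAlgebra.comulLeft] using MA.lact_algebra x y z a a'
    exact (h _).trans (congrArg (fun u => LinearMap.mul' k A (TensorProduct.map (MA.lact.flip a)
      (MA.lact.flip a') u)) (H.T₁_mul_tmul x p r).symm)

/-- The linear data of the right module algebra underlying a bimodule algebra. -/
noncomputable def BimoduleAlgebra.rightMaps (MA : BimoduleAlgebra H A) (hc : H.IsCop H') :
    ModuleMaps hc.hopfMaps.opcop A where
  mul := (LinearMap.mul k A).flip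
  act := MA.ract.flip
  mul_act x y a := MA.ract_mul a y x
  act_unital := by
    rw [← MA.ract_unital]
    congr 1
    ext c
    exact exists_comm
  act_mul x p r a a' := by
    have h : ∀ w, MA.ract (LinearMap.mul' k A (TensorProduct.map (MA.ract a')
        (MA.ract a) w)) x = LinearMap.mul' k A (TensorProduct.map (MA.ract a')
        (MA.ract a) ((H.comul x).right w)) := by
      intro w
      induction w using TensorProduct.induction_on with
      | zero => simp
      | add u v hu hv => simp only [map_add, LinearMap.add_apply, hu, hv]
      | tmul y z => simpa using MA.ract_algebra x y z a' a
    have h' : ∀ w, TensorProduct.lift (LinearMap.mul k A).flip (TensorProduct.map (MA.ract a)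
        (MA.ract a') (TensorProduct.comm k Q Q w))
        = LinearMap.mul' k A (TensorProduct.map (MA.ract a') (MA.ract a) w) := by
      intro w
      induction w using TensorProduct.induction_on with
      | zero => simp
      | add u v hu hv => simp only [map_add, hu, hv]
      | tmul y z => simp
    change MA.ract (TensorProduct.lift (LinearMap.mul k A).flip (TensorProduct.map (MA.ract a)
        (MA.ract a') (TensorProduct.comm k Q Q (H.T₂ (r ⊗ₜ p))))) x
      = TensorProduct.lift (LinearMap.mul k A).flip (TensorProduct.map (MA.ract a)
        (MA.ract a') (TensorProduct.comm k Q Q (H.T₂ (r ⊗ₜ (p * x)))))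
    rw [h', h', h, H.right_T₂]

end Data

/-! ### The twists of a bimodule algebra by a bicomodule algebra -/

theorem existsUnique_comp_comm {k A B : Type*} [Field k] [AddCommGroup A] [Module k A]
    [AddCommGroup B] [Module k B] {P : (A ⊗[k] B →ₗ[k] B ⊗[k] A) → Prop}
    {P' : (B ⊗[k] A →ₗ[k] B ⊗[k] A) → Prop}
    (h : ∀ F, P F ↔ P' (F ∘ₗ (TensorProduct.comm k B A).toLinearMap)) (h' : ∃! F, P' F) :
    ∃! F, P F := by
  obtain ⟨F, hF, hF'⟩ := h'
  refine ⟨F ∘ₗ (TensorProduct.comm k A B).toLinearMap, (h _).2 ?_, fun G hG => ?_⟩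
  · have e : (F ∘ₗ (TensorProduct.comm k A B).toLinearMap) ∘ₗ
        (TensorProduct.comm k B A).toLinearMap = F := by
      ext; simp
    rwa [e]
  · rw [← hF' _ ((h G).1 hG)]
    ext; simp

section Twists

variable {k Q A B : Type*} [Field k] [NonUnitalRing Q] [Module k Q]
  [IsScalarTower k Q Q] [SMulCommClass k Q Q]
  [NonUnitalRing A] [Module k A] [IsScalarTower k A A] [SMulCommClass k A A]
  [NonUnitalRing B] [Module k B] [IsScalarTower k B B] [SMulCommClass k B B]
  {H H' : MultiplierHopfAlgebra k Q} {MA : BimoduleAlgebra H A} {MB : BicomoduleAlgebra H B}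

theorem BimoduleAlgebra.ext_lact {W : Type*} [AddCommGroup W] [Module k W] {F G : A →ₗ[k] W}
    (h : ∀ x a, F (MA.lact x a) = G (MA.lact x a)) : F = G := by
  refine LinearMap.ext_on MA.lact_unital ?_
  rintro _ ⟨x, a, rfl⟩
  exact h x a

theorem BimoduleAlgebra.ext_ract {W : Type*} [AddCommGroup W] [Module k W] {F G : A →ₗ[k] W}
    (h : ∀ a x, F (MA.ract a x) = G (MA.ract a x)) : F = G := by
  refine LinearMap.ext_on MA.ract_unital ?_
  rintro _ ⟨a, x, rfl⟩
  exact h a x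

theorem isLeftTwist_iff (hc : H.IsCop H') {F : B ⊗[k] A →ₗ[k] B ⊗[k] A} :
    IsLeftTwist MA MB F ↔ IsTwist (MB.toLeftComoduleAlgebra.coactionMaps hc) (MA.leftMaps hc) F :=
  Iff.rfl

theorem isLeftTwistInv_iff (hc : H.IsCop H') {F : B ⊗[k] A →ₗ[k] B ⊗[k] A} :
    IsLeftTwistInv MA MB F
      ↔ IsTwistInv (MB.toLeftComoduleAlgebra.coactionMaps hc) (MA.leftMaps hc) F :=
  Iff.rfl

theorem isRightTwist_iff (hc : H.IsCop H') {F : A ⊗[k] B →ₗ[k] B ⊗[k] A} :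
    IsRightTwist MA MB F ↔ IsTwist (MB.toRightComoduleAlgebra.coactionMaps hc) (MA.rightMaps hc)
      (F ∘ₗ (TensorProduct.comm k B A).toLinearMap) := by
  have h : ∀ b x, TensorProduct.comm k Q B ((MB.toRightComoduleAlgebra.coactionMaps hc).Γ₁ b x)
      = MB.Υ₂ x b := fun b x => TensorProduct.comm_comm _ _ _ _
  simp only [IsRightTwist, IsTwist, h]
  exact ⟨fun h b x a => h a x b, fun h a x b => h b x a⟩

theorem isRightTwistInv_iff (hc : H.IsCop H') {F : A ⊗[k] B →ₗ[k] B ⊗[k] A} :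
    IsRightTwistInv MA MB F
      ↔ IsTwistInv (MB.toRightComoduleAlgebra.coactionMaps hc) (MA.rightMaps hc)
      (F ∘ₗ (TensorProduct.comm k B A).toLinearMap) := by
  have h : ∀ b x, TensorProduct.comm k Q B ((MB.toRightComoduleAlgebra.coactionMaps hc).Γ₂ x b)
      = MB.Υ₁ b x := fun b x => TensorProduct.comm_comm _ _ _ _
  simp only [IsRightTwistInv, IsTwistInv, h]
  exact ⟨fun h b x a => h a x b, fun h a x b => h b x a⟩

theorem existsUnique_isLeftTwist (MA : BimoduleAlgebra H A) (MB : BicomoduleAlgebra H B)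
    (hc : H.IsCop H') : ∃! F, IsLeftTwist MA MB F :=
  existsUnique_isTwist (MB.toLeftComoduleAlgebra.coactionMaps hc) (MA.leftMaps hc)

theorem existsUnique_isLeftTwistInv (MA : BimoduleAlgebra H A) (MB : BicomoduleAlgebra H B)
    (hc : H.IsCop H') : ∃! F, IsLeftTwistInv MA MB F :=
  existsUnique_isTwistInv (MB.toLeftComoduleAlgebra.coactionMaps hc) (MA.leftMaps hc)

theorem existsUnique_isRightTwist (MA : BimoduleAlgebra H A) (MB : BicomoduleAlgebra H B)
    (hc : H.IsCop H') : ∃! F, IsRightTwist MA MB F :=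
  existsUnique_comp_comm (fun _ => isRightTwist_iff hc) (existsUnique_isTwist _ _)

theorem existsUnique_isRightTwistInv (MA : BimoduleAlgebra H A) (MB : BicomoduleAlgebra H B)
    (hc : H.IsCop H') : ∃! F, IsRightTwistInv MA MB F :=
  existsUnique_comp_comm (fun _ => isRightTwistInv_iff hc) (existsUnique_isTwistInv _ _)

variable {L : B ⊗[k] A →ₗ[k] B ⊗[k] A} {R : A ⊗[k] B →ₗ[k] B ⊗[k] A}

/-- The two coactions on `b` commute: `(a ⊗ b) ⊗ a'` has the same image under the right twist of
`a` and the left twist of `a'` by `b` in either order. -/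
theorem twist_comm_of_coaction (hL : IsLeftTwist MA MB L) (hR : IsRightTwist MA MB R)
    (a a' : A) (b : B) :
    TensorProduct.rightComm k B A A
        ((L ∘ₗ (TensorProduct.mk k B A).flip a').rTensor A (R (a ⊗ₜ b)))
      = (R ∘ₗ TensorProduct.mk k A B a).rTensor A (L (b ⊗ₜ a')) := by
  have key : ∀ a x y a', TensorProduct.rightComm k B A A
        ((L ∘ₗ (TensorProduct.mk k B A).flip (MA.lact y a')).rTensor A (R (MA.ract a x ⊗ₜ b)))
      = (R ∘ₗ TensorProduct.mk k A B (MA.ract a x)).rTensor A (L (b ⊗ₜ MA.lact y a')) := by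
    intro a x y a'
    -- `Θ (q ⊗ (c ⊗ q')) = (c ⊗ (a ◁ q')) ⊗ (q ▷ a')`
    let Θ : Q ⊗[k] (B ⊗[k] Q) →ₗ[k] (B ⊗[k] A) ⊗[k] A :=
      (TensorProduct.comm k A (B ⊗[k] A)).toLinearMap ∘ₗ
        TensorProduct.map (MA.lact.flip a') ((MA.ract a).lTensor B)
    have h := congrArg Θ (MB.compat x y b)
    have h1 : ∀ v, Θ ((MB.Υ₂ x).lTensor Q v)
        = (R ∘ₗ TensorProduct.mk k A B (MA.ract a x)).rTensor A
          ((MA.lact.flip a').lTensor B (TensorProduct.comm k Q B v)) := by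
      intro v
      induction v using TensorProduct.induction_on with
      | zero => simp
      | add u v hu hv => simp only [map_add, hu, hv]
      | tmul q c =>
        have h2 := hR a x c
        simp [Θ, h2]
    have h3 : ∀ v, Θ (TensorProduct.assoc k Q B Q ((MB.Γ₁.flip y).rTensor Q v))
        = TensorProduct.rightComm k B A A
          ((L ∘ₗ (TensorProduct.mk k B A).flip (MA.lact y a')).rTensor A
            ((MA.ract a).lTensor B v)) := by
      intro v
      induction v using TensorProduct.induction_on with
      | zero => simp
      | add u v hu hv => simp only [map_add, hu, hv]
      | tmul c q =>
        have h2 := hL c y a'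
        simp only [LinearMap.rTensor_tmul, LinearMap.lTensor_tmul, LinearMap.comp_apply,
          LinearMap.flip_apply, TensorProduct.mk_apply, h2]
        induction MB.Γ₁ c y using TensorProduct.induction_on with
        | zero => simp
        | add u v hu hv => simp only [map_add, TensorProduct.add_tmul, hu, hv]
        | tmul s d => simp [Θ]
    rw [hR, hL, ← h3, ← h, h1]
  have h1 : ∀ a x a', TensorProduct.rightComm k B A A
        ((L ∘ₗ (TensorProduct.mk k B A).flip a').rTensor A (R (MA.ract a x ⊗ₜ b)))
      = (R ∘ₗ TensorProduct.mk k A B (MA.ract a x)).rTensor A (L (b ⊗ₜ a')) := by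
    intro a x a'
    have h : (TensorProduct.rightComm k B A A).toLinearMap ∘ₗ
        (LinearMap.rTensorHom A ∘ₗ (TensorProduct.curry L).flip).flip (R (MA.ract a x ⊗ₜ b))
        = (R ∘ₗ TensorProduct.mk k A B (MA.ract a x)).rTensor A ∘ₗ L ∘ₗ TensorProduct.mk k B A b :=
      MA.ext_lact fun y a' => key a x y a'
    exact LinearMap.congr_fun h a'
  have h2 : (TensorProduct.rightComm k B A A).toLinearMap ∘ₗ
      (L ∘ₗ (TensorProduct.mk k B A).flip a').rTensor A ∘ₗ R ∘ₗ (TensorProduct.mk k A B).flip b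
      = (LinearMap.rTensorHom A ∘ₗ TensorProduct.curry R).flip (L (b ⊗ₜ a')) :=
    MA.ext_ract fun a x => h1 a x a'
  exact LinearMap.congr_fun h2 a

/-- The two actions on `a` commute: the left twist by `b` and the right twist by `b'` of the same
element `a` may be performed in either order. -/
theorem twist_comm_of_action (hL : IsLeftTwist MA MB L) (hR : IsRightTwist MA MB R)
    (b b' : B) (a : A) :
    TensorProduct.leftComm k B B A ((L ∘ₗ TensorProduct.mk k B A b).lTensor B (R (a ⊗ₜ b')))
      = (R ∘ₗ (TensorProduct.mk k A B).flip b').lTensor B (L (b ⊗ₜ a)) := by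
  have key : ∀ y a x, TensorProduct.leftComm k B B A
        ((L ∘ₗ TensorProduct.mk k B A b).lTensor B (R (MA.lact y (MA.ract a x) ⊗ₜ b')))
      = (R ∘ₗ (TensorProduct.mk k A B).flip b').lTensor B
        (L (b ⊗ₜ MA.lact y (MA.ract a x))) := by
    intro y a x
    -- `Θ w v = ∑ c ⊗ (c' ⊗ (q ▷ a ◁ q'))` for `v = ∑ q ⊗ c` and `w = ∑ c' ⊗ q'`
    let Θ : B ⊗[k] Q → Q ⊗[k] B →ₗ[k] B ⊗[k] (B ⊗[k] A) := fun w =>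
      TensorProduct.lift (LinearMap.mk₂ k
        (fun (q : Q) (c : B) => c ⊗ₜ[k] (MA.ract (MA.lact q a)).lTensor B w)
        (fun q q' c => by simp [LinearMap.lTensor_add, TensorProduct.tmul_add])
        (fun s q c => by simp [LinearMap.lTensor_smul])
        (fun q c c' => by simp [TensorProduct.add_tmul])
        (fun s q c => by simp [TensorProduct.smul_tmul']))
    have hΘ : ∀ w q c, Θ w (q ⊗ₜ c) = c ⊗ₜ (MA.ract (MA.lact q a)).lTensor B w :=
      fun w q c => TensorProduct.lift.tmul _ _
    have h1 : ∀ v : Q ⊗[k] B, (R ∘ₗ (TensorProduct.mk k A B).flip b').lTensor B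
        ((MA.lact.flip (MA.ract a x)).lTensor B (TensorProduct.comm k Q B v))
        = Θ (MB.Υ₂ x b') v := by
      intro v
      induction v using TensorProduct.induction_on with
      | zero => simp
      | add u v hu hv => simp only [map_add, hu, hv]
      | tmul q c => simp [← MA.lact_ract, hR (MA.lact q a) x b', hΘ]
    have h2 : ∀ w : B ⊗[k] Q, TensorProduct.leftComm k B B A
        ((L ∘ₗ TensorProduct.mk k B A b).lTensor B ((MA.ract (MA.lact y a)).lTensor B w))
        = Θ w (MB.Γ₁ b y) := by
      intro w
      induction w using TensorProduct.induction_on with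
      | zero =>
        induction MB.Γ₁ b y using TensorProduct.induction_on with
        | zero => simp
        | add u v hu hv => rw [map_add, ← hu, ← hv]; simp
        | tmul q c => simp [hΘ]
      | add u v hu hv =>
        simp only [map_add, hu, hv]
        induction MB.Γ₁ b y using TensorProduct.induction_on with
        | zero => simp
        | add u v hu hv => simp only [map_add, ← hu, ← hv]; abel
        | tmul q c => simp [hΘ, TensorProduct.tmul_add]
      | tmul c q =>
        simp only [LinearMap.lTensor_tmul, LinearMap.comp_apply, TensorProduct.mk_apply,
          MA.lact_ract]
        rw [hL]
        induction MB.Γ₁ b y using TensorProduct.induction_on with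
        | zero => simp
        | add u v hu hv => simp only [map_add, TensorProduct.tmul_add, hu, hv]
        | tmul q' c' => simp [hΘ, MA.lact_ract]
    rw [hL, h1, ← MA.lact_ract, hR, h2]
  have h1 : (TensorProduct.leftComm k B B A).toLinearMap ∘ₗ
      (L ∘ₗ TensorProduct.mk k B A b).lTensor B ∘ₗ R ∘ₗ (TensorProduct.mk k A B).flip b'
      = (R ∘ₗ (TensorProduct.mk k A B).flip b').lTensor B ∘ₗ L ∘ₗ TensorProduct.mk k B A b := by
    refine MA.ext_lact fun y a => ?_
    rw [← LinearMap.comp_apply, ← LinearMap.comp_apply]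
    exact LinearMap.congr_fun (MA.ext_ract fun a x => key y a x) a
  exact LinearMap.congr_fun h1 a

end Twists

/-! ### The isomorphisms -/

section Isomorphisms

variable {k Q A B : Type*} [Field k] [NonUnitalRing Q] [Module k Q]
  [IsScalarTower k Q Q] [SMulCommClass k Q Q]
  [NonUnitalRing A] [Module k A] [IsScalarTower k A A] [SMulCommClass k A A]
  [NonUnitalRing B] [Module k B] [IsScalarTower k B B] [SMulCommClass k B B]
  {H H' : MultiplierHopfAlgebra k Q} (MA : BimoduleAlgebra H A) (MB : BicomoduleAlgebra H B)

theorem isLeftTwist_leftTwist (hc : H.IsCop H') : IsLeftTwist MA MB (leftTwist MA MB) :=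
  Classical.epsilon_spec (existsUnique_isLeftTwist MA MB hc).exists

theorem isRightTwist_rightTwist (hc : H.IsCop H') : IsRightTwist MA MB (rightTwist MA MB) :=
  Classical.epsilon_spec (existsUnique_isRightTwist MA MB hc).exists

theorem isLeftTwistInv_leftTwistInv (hc : H.IsCop H') :
    IsLeftTwistInv MA MB (leftTwistInv MA MB) :=
  Classical.epsilon_spec (existsUnique_isLeftTwistInv MA MB hc).exists

theorem isRightTwistInv_rightTwistInv (hc : H.IsCop H') :
    IsRightTwistInv MA MB (rightTwistInv MA MB) :=
  Classical.epsilon_spec (existsUnique_isRightTwistInv MA MB hc).exists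

theorem exists_smashEquiv_right (hc : H.IsCop H') : ∃ Φ : B ⊗[k] A ≃ₗ[k] B ⊗[k] A,
    (∀ u v : B ⊗[k] A, Φ (twistedSmashMulR MA MB u v) = lrSmashMulR MA MB (Φ u) (Φ v)) ∧
      ∀ (b : B) (a : A), Φ (b ⊗ₜ[k] a) = leftTwist MA MB (b ⊗ₜ[k] a) := by
  have hL := isLeftTwist_leftTwist MA MB hc
  have hL' := isLeftTwistInv_leftTwistInv MA MB hc
  have hR := isRightTwist_rightTwist MA MB hc
  have hT := (isLeftTwist_iff hc).1 hL
  have hT' := (isLeftTwistInv_iff hc).1 hL'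
  refine ⟨LinearEquiv.ofLinearMap (leftTwist MA MB) (leftTwistInv MA MB)
    (LinearMap.ext (hT.comp_isTwistInv hT')) (LinearMap.ext (hT'.comp_isTwist hT)), ?_,
    fun b a => rfl⟩
  exact map_twistedMul (rightTwist MA MB) (leftTwist MA MB) (leftTwistInv MA MB)
    (hT.comp_isTwistInv hT') hT.mul_tmul (fun b a a' => hT.tmul_mul b a a')
    (fun a b a' => twist_comm_of_coaction hL hR a a' b)
    (fun b a b' => twist_comm_of_action hL hR b b' a)

theorem exists_smashEquiv_left (hc : H.IsCop H') : ∃ Φ : A ⊗[k] B ≃ₗ[k] A ⊗[k] B,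
    (∀ u v : A ⊗[k] B, Φ (twistedSmashMulL MA MB u v) = lrSmashMulL MA MB (Φ u) (Φ v)) ∧
      ∀ (a : A) (b : B), Φ (a ⊗ₜ[k] b)
        = TensorProduct.comm k B A (rightTwist MA MB (a ⊗ₜ[k] b)) := by
  have hL := isLeftTwist_leftTwist MA MB hc
  have hR := isRightTwist_rightTwist MA MB hc
  have hR' := isRightTwistInv_rightTwistInv MA MB hc
  have hT := (isRightTwist_iff hc).1 hR
  have hT' := (isRightTwistInv_iff hc).1 hR'
  set L := leftTwist MA MB
  set R := rightTwist MA MB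
  set R' := rightTwistInv MA MB
  have e1 : ∀ u : A ⊗[k] B, TensorProduct.comm k B A (R (TensorProduct.comm k B A (R' u))) = u := by
    intro u
    have h := hT.comp_isTwistInv hT' (TensorProduct.comm k A B u)
    simp only [LinearMap.comp_apply, LinearEquiv.coe_coe, TensorProduct.comm_comm] at h
    rw [h, TensorProduct.comm_comm]
  have e2 : ∀ u : A ⊗[k] B, TensorProduct.comm k B A (R' (TensorProduct.comm k B A (R u))) = u := by
    intro u
    have h := hT'.comp_isTwist hT (TensorProduct.comm k A B u)
    simp only [LinearMap.comp_apply, LinearEquiv.coe_coe, TensorProduct.comm_comm] at h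
    rw [h, TensorProduct.comm_comm]
  refine ⟨LinearEquiv.ofLinearMap ((TensorProduct.comm k B A).toLinearMap ∘ₗ R)
    ((TensorProduct.comm k B A).toLinearMap ∘ₗ R')
    (LinearMap.ext e1) (LinearMap.ext e2), ?_, fun a b => rfl⟩
  refine map_twistedMul ((TensorProduct.comm k B A).toLinearMap ∘ₗ L)
    ((TensorProduct.comm k B A).toLinearMap ∘ₗ R)
    ((TensorProduct.comm k B A).toLinearMap ∘ₗ R') e1 ?_ ?_ ?_ ?_
  · intro a a' b
    have h : R ((a * a') ⊗ₜ b) = expandSnd (LinearMap.mul k A).flip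
        (R ∘ₗ (TensorProduct.comm k B A).toLinearMap) a (R (a' ⊗ₜ b)) := hT.tmul_mul b a' a
    rw [LinearMap.comp_apply, LinearMap.comp_apply, LinearEquiv.coe_coe, h]
    induction R (a' ⊗ₜ b) using TensorProduct.induction_on with
    | zero => simp
    | add u v hu hv => simp only [map_add, hu, hv]
    | tmul c d =>
      simp only [expandSnd_tmul, expandFst_tmul, TensorProduct.comm_tmul, LinearMap.comp_apply,
        LinearEquiv.coe_coe, LinearMap.rTensor_comm]
  · intro a b b'
    have h : R (a ⊗ₜ (b * b')) = expandFst (LinearMap.mul k B).flip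
        (R ∘ₗ (TensorProduct.comm k B A).toLinearMap) b' (R (a ⊗ₜ b)) := hT.mul_tmul b' b a
    rw [LinearMap.comp_apply, LinearMap.comp_apply, LinearEquiv.coe_coe, h]
    induction R (a ⊗ₜ b) using TensorProduct.induction_on with
    | zero => simp
    | add u v hu hv => simp only [map_add, hu, hv]
    | tmul c d =>
      simp only [expandSnd_tmul, expandFst_tmul, TensorProduct.comm_tmul, LinearMap.comp_apply,
        LinearEquiv.coe_coe, LinearMap.lTensor_comm, LinearMap.flip_flip]
  · intro b a b'
    have h := congrArg (fun u => TensorProduct.rightComm k A B B (TensorProduct.comm k B (A ⊗[k] B)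
      ((TensorProduct.comm k B A).toLinearMap.lTensor B u))) (twist_comm_of_action hL hR b b' a)
    refine Eq.trans ?_ (h.symm.trans ?_)
    · simp only [LinearMap.comp_apply, LinearEquiv.coe_coe]
      induction L (b ⊗ₜ a) using TensorProduct.induction_on with
      | zero => simp
      | add u v hu hv => simp only [map_add, hu, hv]
      | tmul c d => simp
    · simp only [LinearMap.comp_apply, LinearEquiv.coe_coe]
      induction R (a ⊗ₜ b') using TensorProduct.induction_on with
      | zero => simp
      | add u v hu hv => simp only [map_add, hu, hv]
      | tmul c d =>
        simp only [LinearMap.lTensor_tmul, LinearMap.rTensor_tmul, LinearMap.comp_apply,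
          TensorProduct.mk_apply, TensorProduct.comm_tmul, LinearEquiv.coe_coe]
        induction L (b ⊗ₜ d) using TensorProduct.induction_on with
        | zero => simp
        | add u v hu hv => simp only [map_add, TensorProduct.tmul_add, TensorProduct.add_tmul,
            hu, hv]
        | tmul s t => simp
  · intro a b a'
    have h := congrArg (fun u => TensorProduct.leftComm k A A B
      ((TensorProduct.comm k B A).toLinearMap.lTensor A (TensorProduct.comm k (B ⊗[k] A) A u)))
      (twist_comm_of_coaction hL hR a a' b)
    refine Eq.trans ?_ (h.symm.trans ?_)
    · simp only [LinearMap.comp_apply, LinearEquiv.coe_coe]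
      induction L (b ⊗ₜ a') using TensorProduct.induction_on with
      | zero => simp
      | add u v hu hv => simp only [map_add, hu, hv]
      | tmul c d => simp
    · simp only [LinearMap.comp_apply, LinearEquiv.coe_coe]
      induction R (a ⊗ₜ b) using TensorProduct.induction_on with
      | zero => simp
      | add u v hu hv => simp only [map_add, hu, hv]
      | tmul c d =>
        simp only [LinearMap.lTensor_tmul, LinearMap.rTensor_tmul, LinearMap.comp_apply,
          TensorProduct.mk_apply, TensorProduct.comm_tmul, LinearEquiv.coe_coe,
          LinearMap.flip_apply]
        induction L (c ⊗ₜ a') using TensorProduct.induction_on with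
        | zero => simp
        | add u v hu hv => simp only [map_add, TensorProduct.tmul_add, TensorProduct.add_tmul,
            hu, hv]
        | tmul s t => simp

end Isomorphisms

end MultHopf

/-- The first group of conjuncts says that the counit, the antipode with its inverse, and the maps
that the four products are built from are well defined. The second and the third part are the
isomorphisms `B ⋆_r A ≅ B ⋄_r A`, `b ⋆ a ↦ ∑ b₀ ⋄ (b₍₋₁₎ ▷ a)`, and
`A ⋆_l B ≅ A ⋄_l B`, `a ⋆ b ↦ ∑ (a ◁ b₍₁₎) ⋄ b₀`. -/
theorem proposition2p4p3 {k Q A B : Type*} [Field k]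
    [NonUnitalRing Q] [Module k Q] [IsScalarTower k Q Q] [SMulCommClass k Q Q]
    [NonUnitalRing A] [Module k A] [IsScalarTower k A A] [SMulCommClass k A A]
    [NonUnitalRing B] [Module k B] [IsScalarTower k B B] [SMulCommClass k B B]
    (H : MultHopf.RegularMultiplierHopfAlgebra k Q)
    (MA : MultHopf.BimoduleAlgebra H.toMultiplierHopfAlgebra A)
    (MB : MultHopf.BicomoduleAlgebra H.toMultiplierHopfAlgebra B) :
    ((∃! ε : Q →ₗ[k] k, H.IsCounit ε) ∧
      (∃! S : Q →ₗ[k] Q, H.IsAntipode S) ∧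
      Function.Bijective H.antipode ∧
      (∃! F : B ⊗[k] A →ₗ[k] B ⊗[k] A, MultHopf.IsLeftTwist MA MB F) ∧
      (∃! F : A ⊗[k] B →ₗ[k] B ⊗[k] A, MultHopf.IsRightTwist MA MB F) ∧
      (∃! F : B ⊗[k] A →ₗ[k] B ⊗[k] A, MultHopf.IsLeftTwistInv MA MB F) ∧
      (∃! F : A ⊗[k] B →ₗ[k] B ⊗[k] A, MultHopf.IsRightTwistInv MA MB F)) ∧
    (∃ Φ : B ⊗[k] A ≃ₗ[k] B ⊗[k] A,
      (∀ u v : B ⊗[k] A, Φ (MultHopf.twistedSmashMulR MA MB u v)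
        = MultHopf.lrSmashMulR MA MB (Φ u) (Φ v)) ∧
      ∀ (b : B) (a : A), Φ (b ⊗ₜ[k] a) = MultHopf.leftTwist MA MB (b ⊗ₜ[k] a)) ∧
    (∃ Φ : A ⊗[k] B ≃ₗ[k] A ⊗[k] B,
      (∀ u v : A ⊗[k] B, Φ (MultHopf.twistedSmashMulL MA MB u v)
        = MultHopf.lrSmashMulL MA MB (Φ u) (Φ v)) ∧
      ∀ (a : A) (b : B), Φ (a ⊗ₜ[k] b)
        = TensorProduct.comm k B A (MultHopf.rightTwist MA MB (a ⊗ₜ[k] b))) := by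
  have hc : H.IsCop H.cop := H.cop_comul
  refine ⟨⟨⟨H.counit, H.isCounit_counit, fun ε hε => H.eq_counit hε.1⟩,
    ⟨H.antipode, hc.isAntipode, fun S hS => H.isAntipode_unique hS hc.isAntipode⟩,
    hc.antipode_bijective, MultHopf.existsUnique_isLeftTwist MA MB hc,
    MultHopf.existsUnique_isRightTwist MA MB hc, MultHopf.existsUnique_isLeftTwistInv MA MB hc,
    MultHopf.existsUnique_isRightTwistInv MA MB hc⟩,
    MultHopf.exists_smashEquiv_right MA MB hc, MultHopf.exists_smashEquiv_left MA MB hc⟩
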